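/- All graphs are finite and loopless; an edge set $E$ consists of ordered pairs of vertices, $a\to b$ (a directed edge) means $(a,b)\in E$, $(b,a)\notin E$, and $a-b$ (an undirected edge) means that both pairs are in $E$. The Markov equivalence class of a DAG $G$ consists of all DAGs on the same vertices with the same d-separations as $G$; its essential graph has the same vertices, and its edge set is the union of the edge sets of all members of the class. For an essential graph $\tilde G$, let $\mathrm{MEC}(\tilde G)$ be the set of DAGs whose essential graph is $\tilde G$ and $\mathrm{Size}(\tilde G)=|\mathrm{MEC}(\tilde G)|$. A chain component of a graph is a connected component, containing at least one edge, of the undirected graph that remains when all directed edges are removed. A UCEG is an undirected connected essential graph. For a UCEG $U$ and a vertex $X$ of $U$, the $X$-rooted subclass is the set of DAGs in $\mathrm{MEC}(U)$ in which $X$ has no parents; $\mathrm{Size}(U^X)$ is its number of elements, and the rooted essential graph $U^X$ is the graph on the vertices of $U$ whose edge set is the union of the edge sets of its elements. For graphs $K,H$, the number $\mathrm{Counter}(K,H)$ is defined recursively: it is $1$ if all edges of $K$ are directed, and otherwise it is the product over the chain components $U$ of $K$ of the sum over the vertices $X$ of $U$ of $\mathrm{Counter}(U^X,H)$ if $E(U^X)\subseteq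 E(H)$ and of $0$ if not. The sampler $\mathrm{UnifSamp}(\tilde G)$ keeps a set $\mathcal G$ of components, initially the chain components of $\tilde G$, and a current graph, initially $\tilde G$. While $\mathcal G\neq\emptyset$, it removes an element $U$ from $\mathcal G$ (chosen by any fixed rule), picks a vertex $X$ of $U$ at random with probability $\mathrm{Counter}(U^X,U^X)/\mathrm{Counter}(U,U)$, orients the edges of the current graph that are directed in $U^X$ as they are in $U^X$, and adds the chain components of $U^X$ to $\mathcal G$. When $\mathcal G=\emptyset$ it returns the current graph. **Theorem 3.** Let $\tilde G$ be the essential graph of a DAG. Whatever the rule by which components are taken out of $\mathcal G$, the loop of $\mathrm{UnifSamp}(\tilde G)$ ends after a bounded number of iterations, and its output is uniformly distributed on $\mathrm{MEC}(\tilde G)$: every DAG in $\mathrm{MEC}(\tilde G)$ is returned with probability $1/\mathrm{Size}(\tilde G)$, and no other graph is ever returned. Moreover, every component $U$ that is ever in $\mathcal G$ is a UCEG, and the probability with which a vertex $X$ of $U$ is picked as its root is $\mathrm{Size}(U^X)/\mathrm{Size}(U)$. -/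

import Mathlib

open scoped ENNReal

/-- A finite graph that may have directed and undirected edges, with vertices taken from `V`.
`Edge a b` says `(a, b) ∈ E`; there are no loops. An undirected edge is a pair of opposite edges. -/
@[ext]
structure MGraph (V : Type*) where
  verts : Finset V
  Edge : V → V → Prop
  irrefl : ∀ a, ¬ Edge a a
  left_mem : ∀ a b, Edge a b → a ∈ verts
  right_mem : ∀ a b, Edge a b → b ∈ verts

namespace MGraph

variable {V : Type*}

/-- `a → b`: a directed edge. -/
def Dir (G : MGraph V) (a b : V) : Prop := G.Edge a b ∧ ¬ G.Edge b a

/-- `a - b`: an undirected edge. -/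
def Undir (G : MGraph V) (a b : V) : Prop := G.Edge a b ∧ G.Edge b a

/-- All edges are directed. -/
def IsDirected (G : MGraph V) : Prop := ∀ a b, G.Edge a b → G.Dir a b

/-- All edges are undirected. -/
def IsUndirected (G : MGraph V) : Prop := ∀ a b, G.Edge a b → G.Undir a b

/-- A directed graph without directed cycles. -/
def IsDAG (G : MGraph V) : Prop := G.IsDirected ∧ ∀ a, ¬ Relation.TransGen G.Dir a a

/-- A vertex without parents. -/
def IsRoot (G : MGraph V) (x : V) : Prop := x ∈ G.verts ∧ ∀ a, ¬ G.Dir a x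

/-- The skeleton; the elements of `V` outside `G.verts` are isolated. -/
def skeleton (G : MGraph V) : SimpleGraph V where
  Adj a b := G.Edge a b ∨ G.Edge b a
  symm := ⟨fun _ _ h => h.symm⟩
  loopless := ⟨fun a h => h.elim (G.irrefl a) (G.irrefl a)⟩

/-- What remains after all directed edges are removed. -/
def undirPart (G : MGraph V) : SimpleGraph V where
  Adj a b := G.Undir a b
  symm := ⟨fun _ _ h => ⟨h.2, h.1⟩⟩
  loopless := ⟨fun a h => G.irrefl a h.1⟩

/-- `d` is a descendant of `c`; every vertex is a descendant of itself. -/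
def Desc (G : MGraph V) (c d : V) : Prop := Relation.ReflTransGen G.Dir c d

/-- `S` blocks the quasi-path `p`: some three consecutive vertices `a, c, b` of `p` form
a chain or a fork whose middle vertex is in `S`, or a collider `a → c ← b` such that
no descendant of `c` (in particular not `c`) is in `S`. -/
def Blocks (G : MGraph V) (S : Set V) {x y : V} (p : G.skeleton.Walk x y) : Prop :=
  ∃ a c b : V, [a, c, b] <:+: p.support ∧
    (((G.Dir a c ∧ G.Dir c b) ∨ (G.Dir c a ∧ G.Dir b c) ∨ (G.Dir c a ∧ G.Dir c b)) ∧ c ∈ S ∨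
      (G.Dir a c ∧ G.Dir b c) ∧ ∀ d, G.Desc c d → d ∉ S)

/-- The set of all d-separations of `G`: the triples `(x, y, S)` with distinct vertices `x, y`
and a set `S` of other vertices that blocks every quasi-path (path of the skeleton)
from `x` to `y`. -/
def dSeparations (G : MGraph V) : Set (V × V × Set V) :=
  {t | t.1 ∈ G.verts ∧ t.2.1 ∈ G.verts ∧ t.1 ≠ t.2.1 ∧
    t.2.2 ⊆ (G.verts : Set V) \ {t.1, t.2.1} ∧
    ∀ p : G.skeleton.Walk t.1 t.2.1, p.IsPath → G.Blocks t.2.2 p}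

/-- The Markov equivalence class of `G`: all DAGs on the same vertices with the same
d-separations. -/
def markovClass (G : MGraph V) : Set (MGraph V) :=
  {G' | G'.IsDAG ∧ G'.verts = G.verts ∧ G'.dSeparations = G.dSeparations}

/-- The essential graph of `G`: the union of all members of its Markov equivalence class. -/
def essentialGraph (G : MGraph V) : MGraph V where
  verts := G.verts
  Edge a b := ∃ G' ∈ G.markovClass, G'.Edge a b
  irrefl := by
    rintro a ⟨G', -, h⟩
    exact G'.irrefl a h
  left_mem := by
    rintro a b ⟨G', hG, h⟩
    exact hG.2.1 ▸ G'.left_mem a b h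
  right_mem := by
    rintro a b ⟨G', hG, h⟩
    exact hG.2.1 ▸ G'.right_mem a b h

/-- The Markov equivalence class represented by the essential graph `K`. -/
def mec (K : MGraph V) : Set (MGraph V) := {G | G.IsDAG ∧ G.essentialGraph = K}

/-- `K` is the essential graph of some DAG. -/
def IsEssential (K : MGraph V) : Prop := ∃ G : MGraph V, G.IsDAG ∧ G.essentialGraph = K

/-- Undirected connected essential graph. -/
def IsUCEG (U : MGraph V) : Prop :=
  U.IsEssential ∧ U.IsUndirected ∧ U.verts.Nonempty ∧
    ∀ a ∈ U.verts, ∀ b ∈ U.verts, U.undirPart.Reachable a b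

/-- The number of DAGs in the class represented by `K`. -/
noncomputable def size (K : MGraph V) : ℕ := K.mec.ncard

/-- The `x`-rooted subclass: the members of the class of `U` that have `x` as a root. -/
def rootedClass (U : MGraph V) (x : V) : Set (MGraph V) := {G ∈ U.mec | G.IsRoot x}

/-- The number of DAGs in the `x`-rooted subclass. -/
noncomputable def rootedSize (U : MGraph V) (x : V) : ℕ := (U.rootedClass x).ncard

/-- A member of the class represented by `K` has its edges and vertices in `K`. -/
theorem edge_of_mem_mec {K G : MGraph V} (h : G ∈ K.mec) {a b : V} (hab : G.Edge a b) :
    K.Edge a b := by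
  obtain ⟨hG, rfl⟩ := h
  exact ⟨G, ⟨hG, rfl, rfl⟩, hab⟩

/-- The `x`-rooted essential graph: the union of the members of the `x`-rooted subclass. -/
def rooted (U : MGraph V) (x : V) : MGraph V where
  verts := U.verts
  Edge a b := ∃ G ∈ U.rootedClass x, G.Edge a b
  irrefl := by
    rintro a ⟨G, -, h⟩
    exact G.irrefl a h
  left_mem := by
    rintro a b ⟨G, hG, h⟩
    exact U.left_mem a b (edge_of_mem_mec hG.1 h)
  right_mem := by
    rintro a b ⟨G, hG, h⟩
    exact U.right_mem a b (edge_of_mem_mec hG.1 h)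

open Classical in
/-- The connected component of `v` in the graph that remains after all directed edges of `K`
are removed. -/
noncomputable def component (K : MGraph V) (v : V) : MGraph V where
  verts := {w ∈ K.verts | K.undirPart.Reachable v w}
  Edge a b := K.Undir a b ∧ K.undirPart.Reachable v a
  irrefl a h := K.irrefl a h.1.1
  left_mem a b h := Finset.mem_filter.2 ⟨K.left_mem a b h.1.1, h.2⟩
  right_mem a b h := Finset.mem_filter.2 ⟨K.right_mem a b h.1.1,
    h.2.trans (SimpleGraph.Adj.reachable (G := K.undirPart) h.1)⟩

open Classical in
/-- The (non-trivial) chain components of `K`: the components that contain an undirected edge. -/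
noncomputable def chainComponents (K : MGraph V) : Finset (MGraph V) :=
  {v ∈ K.verts | ∃ w, K.Undir v w}.image K.component

open Classical in
/-- The number of ordered pairs joined by an undirected edge (for termination only). -/
noncomputable def undirCount (K : MGraph V) : ℕ :=
  {p ∈ K.verts ×ˢ K.verts | K.Undir p.1 p.2}.card

/-- Orienting a chain component from a root leaves fewer undirected edges. -/
theorem undirCount_rooted_lt {K U : MGraph V} (hU : U ∈ K.chainComponents) {x : V}
    (hx : x ∈ U.verts) : (U.rooted x).undirCount < K.undirCount := by
  classical
  obtain ⟨v, hv, rfl⟩ := Finset.mem_image.1 hU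
  obtain ⟨-, w, hvw⟩ := Finset.mem_filter.1 hv
  obtain ⟨hxK, hvx⟩ := Finset.mem_filter.1 hx
  have hsub : ∀ a b, ((K.component v).rooted x).Undir a b → K.Undir a b := by
    rintro a b ⟨⟨G, hG, h⟩, -⟩
    exact (edge_of_mem_mec hG.1 h).1
  obtain ⟨y, hxy⟩ : ∃ y, K.Undir x y := by
    obtain ⟨p⟩ := hvx.symm
    cases p with
    | nil => exact ⟨w, hvw⟩
    | cons h _ => exact ⟨_, h⟩
  refine Finset.card_lt_card (Finset.ssubset_iff_subset_ne.2 ⟨?_, ?_⟩)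
  · intro q hq
    have hq' := hsub _ _ (Finset.mem_filter.1 hq).2
    exact Finset.mem_filter.2
      ⟨Finset.mem_product.2 ⟨K.left_mem _ _ hq'.1, K.right_mem _ _ hq'.1⟩, hq'⟩
  · intro heq
    have hmem : (x, y) ∈ ({p ∈ K.verts ×ˢ K.verts | K.Undir p.1 p.2} : Finset (V × V)) :=
      Finset.mem_filter.2
        ⟨Finset.mem_product.2 ⟨K.left_mem _ _ hxy.1, K.right_mem _ _ hxy.1⟩, hxy⟩
    rw [← heq] at hmem
    obtain ⟨-, G, hG, h⟩ := (Finset.mem_filter.1 hmem).2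
    exact hG.2.2 y (hG.1.1.1 _ _ h)

open Classical in
/-- The recursive counting procedure `Counter(K, H)` with hypothesis graph `H`. -/
noncomputable def counter (K H : MGraph V) : ℕ :=
  if K.IsDirected then 1
  else ∏ U ∈ K.chainComponents.attach, ∑ x ∈ U.1.verts.attach,
    if ∀ a b, (U.1.rooted x.1).Edge a b → H.Edge a b then counter (U.1.rooted x.1) H else 0
termination_by K.undirCount
decreasing_by exact undirCount_rooted_lt U.2 x.2

open Classical in
/-- The probability `Counter(Uˣ, Uˣ) / Counter(U, U)` with which `x` is set as the root of `U`. -/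
noncomputable def rootProb (U : MGraph V) (x : V) : ℝ≥0∞ :=
  if x ∈ U.verts then
    (counter (U.rooted x) (U.rooted x) : ℝ≥0∞) / (counter U U : ℝ≥0∞)
  else 0

/-- `K` after the edges that are directed in `L` have been given that direction in `K`:
an undirected edge `a - b` of `K` becomes `a → b` if `a → b` in `L`. -/
def orient (K L : MGraph V) : MGraph V where
  verts := K.verts
  Edge a b := K.Edge a b ∧ ¬ L.Dir b a
  irrefl a h := K.irrefl a h.1
  left_mem a b h := K.left_mem a b h.1
  right_mem a b h := K.right_mem a b h.1

end MGraph

/-- State of the sampler's loop: the components still to be treated, and the current graph. -/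
structure SamplerState (V : Type*) where
  work : Finset (MGraph V)
  graph : MGraph V

namespace SamplerState

variable {V : Type*}

/-- Before the first iteration. -/
noncomputable def init (K : MGraph V) : SamplerState V := ⟨K.chainComponents, K⟩

open Classical in
/-- The state after an iteration that took `U` out of the work set and chose the root `x`. -/
noncomputable def next (σ : SamplerState V) (U : MGraph V) (x : V) : SamplerState V :=
  ⟨(σ.work \ {U}) ∪ (U.rooted x).chainComponents, σ.graph.orient (U.rooted x)⟩

open Classical in
/-- One iteration of the loop, as a random transition; `pick` tells which component is taken.
If the work set is empty, the loop has ended and the state no longer changes. Should the numbers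
`rootProb` not be a probability distribution on the vertices of the component, then the
iteration is undefined; it is stuck, so that the loop never ends. -/
noncomputable def step (pick : SamplerState V → MGraph V) (σ : SamplerState V) :
    PMF (SamplerState V) :=
  if h : σ.work.Nonempty ∧ ∑ x ∈ (pick σ).verts, (pick σ).rootProb x = 1 then
    (PMF.ofFinset (pick σ).rootProb (pick σ).verts h.2
      (fun _ hx => if_neg hx)).map (σ.next (pick σ))
  else PMF.pure σ

/-- The law of the state after `n` iterations of `UnifSamp(K)`. -/
noncomputable def run (pick : SamplerState V → MGraph V) (K : MGraph V) :
    ℕ → PMF (SamplerState V)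
  | 0 => PMF.pure (init K)
  | n + 1 => (run pick K n).bind (step pick)

end SamplerState

/-! The proof works with extendable graphs `L`: some acyclic orientation of the undirected edges
creates no new unshielded collider, and `a → b - c` always entails `a → c`. The latter rule makes
the chain components independent of each other. The parents of a vertex inside a component are
pairwise joined by undirected edges, so an extension of `L` restricts to an acyclic orientation of
each component without unshielded colliders, and such an orientation of a connected graph has
exactly one root (`IsUCEG.existsUnique_root`).

Consequently the extensions of `L` split according to the root `x` they induce on a chain component
`U`, and the part with root `x` consists of the extensions of `L` with `U` oriented as in `U.rooted
x` (`IsExtendable.mem_extensions_orient_iff`). This graph is again extendable, and in its set of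
chain components `U` is replaced by those of `U.rooted x`. Induction gives the product formula
`IsExtendable.ncard_eq_prod`, hence the correctness of `counter`. It also shows that the root
probability is the proportion of extensions of `L` that have root `x` on `U`. One iteration
therefore preserves the average, over the random state, of the uniform distribution on the
extensions of the current graph (`Valid.step_bind`). Every iteration removes undirected edges; once
none is left, the current graph is its own only extension and the average is the law of the output.

Two facts link this to d-separation. Markov equivalence means the same skeleton and the same
unshielded colliders (`IsDAG.mem_markovClass_iff`): one direction reverses covered arrows one at a
time, the other reads both data off the d-separations. Moreover essential and rooted essential
graphs are extendable, with the class they represent as their set of extensions. Both are unions of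
all acyclic orientations with prescribed arrows, and `isExtendable_of_union` treats them together by
closing the prescribed arrows under orientation rules. -/

namespace MGraph

variable {V : Type*}

/-! ### Directed acyclic graphs -/

/-- The unshielded collider `a → c ← b`. -/
def VStruct (G : MGraph V) (a c b : V) : Prop :=
  G.Dir a c ∧ G.Dir b c ∧ a ≠ b ∧ ¬ G.skeleton.Adj a b

theorem Dir.adj {G : MGraph V} {a b : V} (h : G.Dir a b) : G.skeleton.Adj a b := Or.inl h.1

theorem Dir.not_dir {G : MGraph V} {a b : V} (h : G.Dir a b) : ¬ G.Dir b a := fun h' => h.2 h'.1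

theorem IsDAG.edge_iff {G : MGraph V} (hG : G.IsDAG) {a b : V} : G.Edge a b ↔ G.Dir a b :=
  ⟨hG.1 a b, And.left⟩

theorem IsDAG.adj_iff {G : MGraph V} (hG : G.IsDAG) {a b : V} :
    G.skeleton.Adj a b ↔ G.Dir a b ∨ G.Dir b a := by
  rw [← hG.edge_iff, ← hG.edge_iff]; rfl

theorem IsDAG.dir_trans {G : MGraph V} (hG : G.IsDAG) {a b c : V} (hab : G.Dir a b)
    (hbc : G.Dir b c) (hac : G.skeleton.Adj a c) : G.Dir a c := by
  rcases hG.adj_iff.1 hac with h | h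
  · exact h
  · exact absurd (.tail (.tail (.single hab) hbc) h) (hG.2 a)

/-- A DAG is determined by its vertices and its arrows. -/
theorem IsDAG.ext_dir {G H : MGraph V} (hG : G.IsDAG) (hH : H.IsDAG) (hv : G.verts = H.verts)
    (h : ∀ a b, G.Dir a b ↔ H.Dir a b) : G = H := by
  ext a b
  · rw [hv]
  · rw [hG.edge_iff, hH.edge_iff, h]

/-- A graph whose edges increase a rank function is a DAG. -/
theorem isDAG_of_rank {G : MGraph V} {α : Type*} [Preorder α] (f : V → α) (h : ∀ a b, G.Edge a b → f a < f b) :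
    G.IsDAG := by
  refine ⟨fun a b e => ⟨e, fun e' => absurd (h _ _ e) (h _ _ e').asymm⟩, fun a ha => ?_⟩
  have key : ∀ b, Relation.TransGen G.Dir a b → f a < f b := by
    intro b hb
    induction hb with
    | single e => exact h _ _ e.1
    | tail _ e ih => exact ih.trans (h _ _ e.1)
  exact lt_irrefl _ (key a ha)

open Classical in
/-- The number of vertices with a non-trivial directed path to `v`. -/
noncomputable def depth (G : MGraph V) (v : V) : ℕ :=
  {u ∈ G.verts | Relation.TransGen G.Dir u v}.card

theorem depth_lt {G : MGraph V} (hG : ∀ a, ¬ Relation.TransGen G.Dir a a) {a b : V}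
    (h : G.Dir a b) : G.depth a < G.depth b := by
  classical
  refine Finset.card_lt_card (Finset.ssubset_iff_subset_ne.2 ⟨fun u hu => ?_, fun he => ?_⟩)
  · rw [Finset.mem_filter] at hu ⊢
    exact ⟨hu.1, hu.2.tail h⟩
  · have : a ∈ {u ∈ G.verts | Relation.TransGen G.Dir u b} :=
      Finset.mem_filter.2 ⟨G.left_mem _ _ h.1, .single h⟩
    rw [← he] at this
    exact hG a (Finset.mem_filter.1 this).2

/-! ### Reachability along active walks

A state `(v, m)` stands for an arrival at `v`, with `m = true` if the last edge points to `v`. -/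

/-- One step of an active walk given `S`: the vertex left is in `S` exactly if it is a collider. -/
def BallStep (G : MGraph V) (S : Set V) (p q : V × Bool) : Prop :=
  G.skeleton.Adj p.1 q.1 ∧ (q.2 = true ↔ G.Dir p.1 q.1) ∧
    ((p.2 = true ∧ G.Dir q.1 p.1) ↔ p.1 ∈ S)

/-- Reachability along active walks. -/
abbrev Reach (G : MGraph V) (S : Set V) : V × Bool → V × Bool → Prop :=
  Relation.ReflTransGen (G.BallStep S)

/-- The consecutive vertices `a, c, b` block. -/
def BlockedAt (G : MGraph V) (S : Set V) (a c b : V) : Prop :=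
  ((G.Dir a c ∧ G.Dir c b) ∨ (G.Dir c a ∧ G.Dir b c) ∨ (G.Dir c a ∧ G.Dir c b)) ∧ c ∈ S ∨
    (G.Dir a c ∧ G.Dir b c) ∧ ∀ d, G.Desc c d → d ∉ S

theorem BlockedAt.symm {G : MGraph V} {S : Set V} {a c b : V} (h : G.BlockedAt S a c b) :
    G.BlockedAt S b c a := by
  unfold BlockedAt at *; tauto

/-- A list of vertices without blocking triple. -/
def Open (G : MGraph V) (S : Set V) (l : List V) : Prop :=
  ∀ a c b, [a, c, b] <:+: l → ¬ G.BlockedAt S a c b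

theorem Open.of_infix {G : MGraph V} {S : Set V} {l l' : List V} (h : G.Open S l)
    (hl : l' <:+: l) : G.Open S l' := fun a c b hi => h a c b (hi.trans hl)

theorem Open.of_cons {G : MGraph V} {S : Set V} {a : V} {l : List V} (h : G.Open S (a :: l)) :
    G.Open S l := h.of_infix (List.suffix_cons a l).isInfix

theorem Open.reverse {G : MGraph V} {S : Set V} {l : List V} (h : G.Open S l) :
    G.Open S l.reverse := by
  intro a c b hi hb
  refine h b c a ?_ hb.symm
  rw [← List.reverse_infix]
  simpa using hi

theorem open_cons_cons_cons {G : MGraph V} {S : Set V} {a c b : V} {l : List V} :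
    G.Open S (a :: c :: b :: l) ↔ ¬ G.BlockedAt S a c b ∧ G.Open S (c :: b :: l) := by
  constructor
  · intro h
    exact ⟨h a c b (List.prefix_append [a, c, b] l).isInfix, h.of_cons⟩
  · rintro ⟨h1, h2⟩ a' c' b' hi
    rcases List.infix_cons_iff.1 hi with hi | hi
    · simp only [List.cons_prefix_cons, List.nil_prefix, and_true] at hi
      obtain ⟨rfl, rfl, rfl⟩ := hi
      exact h1
    · exact h2 _ _ _ hi

theorem open_of_length_le {G : MGraph V} {S : Set V} {l : List V} (h : l.length ≤ 2) :
    G.Open S l := by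
  intro a c b hi
  have := hi.length_le
  simp at this
  omega

/-- The only triple of the concatenation that lies in neither piece is the one centred at `v`. -/
theorem open_append {G : MGraph V} {S : Set V} (v : V) (l₂ : List V) :
    ∀ l₁ : List V, G.Open S (l₁ ++ [v]) → G.Open S (v :: l₂) →
      (∀ u w, u ∈ l₁.getLast? → w ∈ l₂.head? → ¬ G.BlockedAt S u v w) →
      G.Open S (l₁ ++ v :: l₂)
  | [], _, h2, _ => h2
  | [a], _, h2, h3 => by
    cases l₂ with
    | nil => exact open_of_length_le (by simp)
    | cons w l => exact open_cons_cons_cons.2 ⟨h3 a w (by simp) (by simp), h2⟩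
  | [a, b], h1, h2, h3 => by
    refine open_cons_cons_cons.2 ⟨(open_cons_cons_cons.1 h1).1, ?_⟩
    exact open_append v l₂ [b] (open_of_length_le (by simp)) h2 (by simpa using h3)
  | a :: b :: c :: l₁, h1, h2, h3 => by
    refine open_cons_cons_cons.2 ⟨(open_cons_cons_cons.1 h1).1, ?_⟩
    exact open_append v l₂ (b :: c :: l₁) h1.of_cons h2 (by simpa using h3)

theorem blocks_iff {G : MGraph V} {S : Set V} {x y : V} (p : G.skeleton.Walk x y) :
    G.Blocks S p ↔ ¬ G.Open S p.support := by
  simp only [Blocks, Open, BlockedAt, not_forall, not_not, exists_prop]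

theorem IsDAG.not_blockedAt_iff {G : MGraph V} (hG : G.IsDAG) {S : Set V} {a c b : V}
    (h1 : G.skeleton.Adj a c) (h2 : G.skeleton.Adj c b) :
    ¬ G.BlockedAt S a c b ↔
      ((G.Dir a c ∧ G.Dir b c) ∧ ∃ d, G.Desc c d ∧ d ∈ S) ∨ (¬ (G.Dir a c ∧ G.Dir b c) ∧ c ∉ S) := by
  rw [hG.adj_iff] at h1 h2
  have := @Dir.not_dir _ G a c
  have := @Dir.not_dir _ G c b
  have h3 : (∃ d, G.Desc c d ∧ d ∈ S) ↔ ¬ ∀ d, G.Desc c d → d ∉ S := by push Not; rfl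
  rw [h3]
  unfold BlockedAt
  tauto

/-- A collider with a descendant in `S` may be passed by way of this descendant. -/
theorem reach_detour {G : MGraph V} {S : Set V} {v d : V}
    (h : G.Desc v d) (hd : d ∈ S) (hv : v ∉ S) : G.Reach S (v, true) (v, false) := by
  induction h using Relation.ReflTransGen.head_induction_on with
  | refl => exact absurd hd hv
  | @head a c hac _ ih =>
    have down : G.BallStep S (a, true) (c, true) :=
      ⟨hac.adj, by simpa using hac, by simp [hac.not_dir, hv]⟩
    by_cases hc : c ∈ S
    · exact .tail (.single down) ⟨hac.adj.symm, by simpa using hac.not_dir, by simp [hac, hc]⟩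
    · exact .tail ((Relation.ReflTransGen.single down).trans (ih hc))
        ⟨hac.adj.symm, by simpa using hac.not_dir, by simp [hc]⟩

-- Non-colliders of an open path are passed directly. A collider outside `S` is passed by descending
-- to a descendant in `S` and climbing back, which is why active walks may demand that colliders
-- themselves lie in `S`.
open Classical in
theorem IsDAG.reach_of_open {G : MGraph V} (hG : G.IsDAG) {S : Set V} {u y : V}
    (p : G.skeleton.Walk u y) : ∀ t, G.skeleton.Adj t u → G.Open S (t :: p.support) →
      ∃ m, G.Reach S (u, decide (G.Dir t u)) (y, m) := by
  induction p with
  | nil => exact fun t _ _ => ⟨_, .refl⟩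
  | @cons u w y h q ih =>
    intro t htu ho
    rw [SimpleGraph.Walk.support_cons] at ho
    obtain ⟨m, hm⟩ := ih u h ho.of_cons
    have ht : ¬ G.BlockedAt S t u w := by
      rw [← SimpleGraph.Walk.cons_tail_support] at ho
      exact (open_cons_cons_cons.1 ho).1
    refine ⟨m, Relation.ReflTransGen.trans ?_ hm⟩
    rcases (hG.not_blockedAt_iff htu h).1 ht with ⟨⟨h1, h2⟩, d, hd, hdS⟩ | ⟨h1, h2⟩
    · by_cases hu : u ∈ S
      · exact .single ⟨h, by simp, by simp [h1, h2, hu]⟩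
      · rw [decide_eq_true h1]
        exact .tail (reach_detour hd hdS hu) ⟨h, by simp, by simp [hu]⟩
    · exact .single ⟨h, by simp, by simp [h1, h2]⟩

/-- The walk is recorded backwards, newest vertex first, so that each step is a `cons`. The last two
clauses keep what is needed to check the next triple: the direction of arrival, and at the start
that the vertex is not in `S`. -/
theorem IsDAG.exists_open_of_reach {G : MGraph V} (hG : G.IsDAG) {S : Set V} {x : V} (hx : x ∉ S)
    {q : V × Bool} (h : G.Reach S (x, false) q) :
    ∃ l : List V, (q.1 :: l).IsChain G.skeleton.Adj ∧ (q.1 :: l).getLast (by simp) = x ∧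
      G.Open S (q.1 :: l) ∧ (∀ u ∈ l.head?, (q.2 = true ↔ G.Dir u q.1)) ∧
      (l = [] → q.1 ∉ S) := by
  induction h with
  | refl => exact ⟨[], by simp, rfl, open_of_length_le (by simp), by simp, fun _ => hx⟩
  | @tail b c _ hbc ih =>
    obtain ⟨l, h1, h2, h3, h4, h5⟩ := ih
    refine ⟨b.1 :: l, ?_, ?_, ?_, ?_, by simp⟩
    · exact List.IsChain.cons_cons hbc.1.symm h1
    · simpa using h2
    · cases l with
      | nil => exact open_of_length_le (by simp)
      | cons u l =>
        refine open_cons_cons_cons.2 ⟨?_, h3⟩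
        have h4' := h4 u (by simp)
        rw [hG.not_blockedAt_iff hbc.1.symm h1.rel]
        have := hbc.2.2
        rw [h4'] at this
        by_cases hS : b.1 ∈ S
        · exact Or.inl ⟨(this.2 hS).symm, b.1, .refl, hS⟩
        · exact Or.inr ⟨fun h => hS (this.1 h.symm), hS⟩
    · simpa using hbc.2.1

/-- The walk follows arrows forward until its first turn. That turn is a collider, and since it is
open it has a descendant in `S`, which is also a descendant of `u`. -/
theorem IsDAG.transGen_or_of_open {G : MGraph V} (hG : G.IsDAG) {S : Set V} :
    ∀ (l : List V) (u v : V), G.Dir u v → (u :: v :: l).IsChain G.skeleton.Adj →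
      G.Open S (u :: v :: l) →
      Relation.TransGen G.Dir u ((v :: l).getLast (by simp)) ∨ ∃ d, G.Desc u d ∧ d ∈ S
  | [], u, v, huv, _, _ => Or.inl (.single huv)
  | w :: l, u, v, huv, hc, ho => by
    have hvw := hc.of_cons.rel
    rcases hG.adj_iff.1 hvw with h | h
    · rcases hG.transGen_or_of_open l v w h hc.of_cons ho.of_cons with h' | ⟨d, hd, hS⟩
      · exact Or.inl (Relation.TransGen.head huv (by simpa using h'))
      · exact Or.inr ⟨d, .head huv hd, hS⟩
    · rcases (hG.not_blockedAt_iff hc.rel hvw).1 (open_cons_cons_cons.1 ho).1 with h' | h'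
      · obtain ⟨-, d, hd, hS⟩ := h'
        exact Or.inr ⟨d, .head huv hd, hS⟩
      · exact absurd ⟨huv, h⟩ h'.1

theorem _root_.List.exists_append_of_not_nodup {α : Type*} :
    ∀ {l : List α}, ¬ l.Nodup → ∃ l₁ v l₂ l₃, l = l₁ ++ v :: l₂ ++ v :: l₃
  | [], h => absurd List.nodup_nil h
  | a :: l, h => by
    by_cases ha : a ∈ l
    · obtain ⟨s, t, rfl⟩ := List.append_of_mem ha
      exact ⟨[], a, s, t, by simp⟩
    · have hl : ¬ l.Nodup := fun hl => h (List.nodup_cons.2 ⟨ha, hl⟩)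
      obtain ⟨l₁, v, l₂, l₃, rfl⟩ := List.exists_append_of_not_nodup hl
      exact ⟨a :: l₁, v, l₂, l₃, by simp⟩

/-- A loop may be cut out of an open walk. -/
theorem IsDAG.open_cut {G : MGraph V} (hG : G.IsDAG) {S : Set V} {l₁ l₂ l₃ : List V} {v : V}
    (hc : (l₁ ++ v :: l₂ ++ v :: l₃).IsChain G.skeleton.Adj)
    (ho : G.Open S (l₁ ++ v :: l₂ ++ v :: l₃)) :
    (l₁ ++ v :: l₃).IsChain G.skeleton.Adj ∧ G.Open S (l₁ ++ v :: l₃) := by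
  have hloop : ∀ s t, s ++ v :: l₂ ++ v :: t = s ++ (v :: (l₂ ++ v :: t)) := by simp
  refine ⟨?_, open_append _ _ _ (ho.of_infix ⟨[], l₂ ++ v :: l₃, by simp⟩)
    (ho.of_infix ⟨l₁ ++ v :: l₂, [], by simp⟩) ?_⟩
  · have h1 : (l₁ ++ [v]).IsChain G.skeleton.Adj := hc.infix ⟨[], l₂ ++ v :: l₃, by simp⟩
    have h2 : (v :: l₃).IsChain G.skeleton.Adj := hc.infix ⟨l₁ ++ v :: l₂, [], by simp⟩
    rw [List.isChain_append] at h1 ⊢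
    exact ⟨h1.1, h2, by simpa using h1.2.2⟩
  · intro u w hu hw
    obtain ⟨s, rfl⟩ : ∃ s, l₁ = s ++ [u] := by
      rcases List.eq_nil_or_concat l₁ with rfl | ⟨s, z, rfl⟩
      · simp at hu
      · simp at hu; exact ⟨s, by simp [hu]⟩
    obtain ⟨t, rfl⟩ : ∃ t, l₃ = w :: t := by
      cases l₃ with
      | nil => simp at hw
      | cons z t => simp at hw; exact ⟨t, by simp [hw]⟩
    have huv : G.skeleton.Adj u v :=
      (hc.infix (l₁ := [u, v]) ⟨s, l₂ ++ v :: w :: t, by simp⟩).rel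
    have hvw : G.skeleton.Adj v w :=
      (hc.infix (l₁ := [v, w]) ⟨s ++ [u] ++ v :: l₂, t, by simp⟩).rel
    obtain ⟨r, l, hr⟩ : ∃ r l, l₂ ++ [v] = r :: l := by
      cases l₂ with
      | nil => exact ⟨v, [], rfl⟩
      | cons r l => exact ⟨r, l ++ [v], rfl⟩
    obtain ⟨r', l', hr'⟩ : ∃ r l, v :: l₂ = l ++ [r] := by
      rcases List.eq_nil_or_concat l₂ with rfl | ⟨s, z, rfl⟩
      · exact ⟨v, [], rfl⟩
      · exact ⟨z, v :: s, by simp⟩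
    have i1 : (u :: v :: r :: l) <:+: s ++ [u] ++ v :: l₂ ++ v :: w :: t :=
      ⟨s, w :: t, by rw [← hr]; simp⟩
    have i2 : [r', v, w] <:+: s ++ [u] ++ v :: l₂ ++ v :: w :: t :=
      ⟨s ++ [u] ++ l', t, by
        have : s ++ [u] ++ v :: l₂ ++ v :: w :: t = s ++ [u] ++ (v :: l₂) ++ v :: w :: t := by simp
        rw [this, hr']; simp⟩
    have c1 := hc.infix i1
    have c2 := hc.infix i2
    have o1 := ho.of_infix i1
    have t1 := (hG.not_blockedAt_iff c1.rel c1.of_cons.rel).1 (open_cons_cons_cons.1 o1).1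
    have t2 := (hG.not_blockedAt_iff c2.rel c2.of_cons.rel).1
      (open_cons_cons_cons.1 (ho.of_infix i2)).1
    rw [hG.not_blockedAt_iff huv hvw]
    -- The new triple at `v` is compared with the old triples at its first and second visit. If it
    -- is a collider but the first visit was not, the loop leaves `v` along an arrow; by acyclicity
    -- it cannot return by arrows alone, so `v` has a descendant in `S`. If it is not a collider,
    -- one of the old triples was not one either, and `v ∉ S`.
    by_cases hcol : G.Dir u v ∧ G.Dir w v
    · refine Or.inl ⟨hcol, ?_⟩
      rcases t1 with t1 | t1
      · exact t1.2
      · have hvr : G.Dir v r := by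
          rcases hG.adj_iff.1 c1.of_cons.rel with h | h
          · exact h
          · exact absurd ⟨hcol.1, h⟩ t1.1
        rcases hG.transGen_or_of_open l v r hvr c1.of_cons o1.of_cons with h | h
        · have hlast : (r :: l).getLast (by simp) = v := by
            simp only [← hr, List.getLast_append_singleton]
          rw [hlast] at h
          exact absurd h (hG.2 v)
        · exact h
    · refine Or.inr ⟨hcol, ?_⟩
      rcases not_and_or.1 hcol with h | h
      · rcases t1 with t1 | t1
        · exact absurd t1.1.1 h
        · exact t1.2
      · rcases t2 with t2 | t2
        · exact absurd t2.1.2 h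
        · exact t2.2

theorem IsDAG.exists_nodup_open {G : MGraph V} (hG : G.IsDAG) {S : Set V} {x y : V} :
    ∀ (n : ℕ) (l : List V), l.length = n → l.IsChain G.skeleton.Adj → G.Open S l →
      l.head? = some y → l.getLast? = some x →
      ∃ l' : List V, l'.IsChain G.skeleton.Adj ∧ G.Open S l' ∧ l'.head? = some y ∧
        l'.getLast? = some x ∧ l'.Nodup := by
  intro n
  induction n using Nat.strong_induction_on with
  | _ n ih =>
    intro l hn hc ho hy hx
    by_cases hl : l.Nodup
    · exact ⟨l, hc, ho, hy, hx, hl⟩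
    · obtain ⟨l₁, v, l₂, l₃, rfl⟩ := List.exists_append_of_not_nodup hl
      obtain ⟨h1, h2⟩ := hG.open_cut hc ho
      refine ih (l₁ ++ v :: l₃).length ?_ _ rfl h1 h2 ?_ ?_
      · rw [← hn]; simp
      · cases l₁ <;> simpa using hy
      · rw [List.getLast?_append_of_ne_nil _ (by simp)] at hx ⊢; exact hx

/-- d-separation is unreachability. -/
theorem IsDAG.mem_dSeparations_iff {G : MGraph V} (hG : G.IsDAG) {x y : V} {S : Set V} :
    (x, y, S) ∈ G.dSeparations ↔ x ∈ G.verts ∧ y ∈ G.verts ∧ x ≠ y ∧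
      S ⊆ (G.verts : Set V) \ {x, y} ∧ ∀ m, ¬ G.Reach S (x, false) (y, m) := by
  simp only [dSeparations, Set.mem_ofPred_eq]
  refine and_congr_right fun _ => and_congr_right fun _ => and_congr_right fun hxy =>
    and_congr_right fun hS => ?_
  have hx : x ∉ S := fun h => by simpa using (hS h).2
  constructor
  · intro h m hm
    obtain ⟨l, h1, h2, h3, -, -⟩ := hG.exists_open_of_reach hx hm
    obtain ⟨l', c, o, hh, hl, hnd⟩ := hG.exists_nodup_open (y := y) _ _ rfl h1 h3 rfl
      (by rw [List.getLast?_eq_some_getLast (by simp), h2])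
    have hne : l'.reverse ≠ [] := by rintro h0; simp at h0; simp [h0] at hh
    have c' : l'.reverse.IsChain G.skeleton.Adj := by
      rw [List.isChain_reverse]
      exact c.imp fun _ _ h => h.symm
    have e1 : l'.reverse.head hne = x := by
      have := List.head?_eq_some_head hne
      rw [List.head?_reverse, hl] at this
      exact (Option.some.inj this).symm
    have e2 : l'.reverse.getLast hne = y := by
      have := List.getLast?_eq_some_getLast hne
      rw [List.getLast?_reverse, hh] at this
      exact (Option.some.inj this).symm
    have hb := h ((SimpleGraph.Walk.ofSupport _ hne c').copy e1 e2) (by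
      rw [SimpleGraph.Walk.isPath_def]
      simpa using hnd)
    rw [blocks_iff] at hb
    exact hb (by simpa using o.reverse)
  · intro h p _
    rw [blocks_iff]
    intro ho
    cases p with
    | nil => exact hxy rfl
    | @cons _ w _ hxw q =>
      classical
      obtain ⟨m, hm⟩ := hG.reach_of_open q x hxw (by simpa using ho)
      exact h m (.head ⟨hxw, by simp, by simp [hx]⟩ hm)

/-! ### Reversing covered arrows -/

/-- `G'` is `G` with the arrow `a → b` reversed, where the parents of `b` are `a` and its parents. -/
structure IsCoveredFlip (G G' : MGraph V) (a b : V) : Prop where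
  dag : G.IsDAG
  dag' : G'.IsDAG
  verts_eq : G'.verts = G.verts
  dir : G.Dir a b
  parents : ∀ c, G.Dir c b ↔ G.Dir c a ∨ c = a
  dir_iff : ∀ u v, G'.Dir u v ↔ (G.Dir u v ∧ ¬ (u = a ∧ v = b)) ∨ (u = b ∧ v = a)

namespace IsCoveredFlip

variable {G G' : MGraph V} {a b : V}

theorem symm (h : IsCoveredFlip G G' a b) : IsCoveredFlip G' G b a where
  dag := h.dag'
  dag' := h.dag
  verts_eq := h.verts_eq.symm
  dir := (h.dir_iff _ _).2 (.inr ⟨rfl, rfl⟩)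
  parents c := by
    have h1 := h.dir_iff c a
    have h2 := h.dir_iff c b
    have h3 := h.parents c
    have h4 : a ≠ b := fun e => G.irrefl a (e ▸ h.dir.1)
    have h5 : c = a → ¬ G.Dir c a := fun e hh => G.irrefl a (e ▸ hh.1)
    grind
  dir_iff u v := by
    have h1 := h.dir_iff u v
    have h2 := h.dir
    have h3 := h.dir.not_dir
    have h4 : a ≠ b := fun e => G.irrefl a (e ▸ h.dir.1)
    grind

theorem adj_iff (h : IsCoveredFlip G G' a b) (u v : V) :
    G'.skeleton.Adj u v ↔ G.skeleton.Adj u v := by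
  rw [h.dag.adj_iff, h.dag'.adj_iff, h.dir_iff, h.dir_iff]
  have := h.dir
  grind

/-- An unshielded collider containing `a → b` would have another parent of `b` not adjacent to `a`,
but the other parents of `b` are parents of `a`. -/
theorem vStruct_iff (h : IsCoveredFlip G G' a b) (u c w : V) :
    G'.VStruct u c w ↔ G.VStruct u c w := by
  have key : ∀ {G G' : MGraph V} {a b : V}, IsCoveredFlip G G' a b → ∀ u c w,
      G.VStruct u c w → G'.VStruct u c w := by
    intro G G' a b h u c w ⟨h1, h2, h3, h4⟩
    refine ⟨?_, ?_, h3, fun h' => h4 ((h.adj_iff _ _).1 h')⟩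
    · refine (h.dir_iff _ _).2 (.inl ⟨h1, ?_⟩)
      rintro ⟨rfl, rfl⟩
      rcases (h.parents w).1 h2 with h5 | h5
      · exact h4 h5.adj.symm
      · exact h3 h5.symm
    · refine (h.dir_iff _ _).2 (.inl ⟨h2, ?_⟩)
      rintro ⟨rfl, rfl⟩
      rcases (h.parents u).1 h1 with h5 | h5
      · exact h4 h5.adj
      · exact h3 h5
  exact ⟨key h.symm u c w, key h u c w⟩

/-- What an active walk in `G` from `(x, false)` to a state yields for `G'`. -/
def Sim (G' : MGraph V) (a b x : V) (S : Set V) (q : V × Bool) : Prop :=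
  (q.1 ≠ a → q.1 ≠ b → G'.Reach S (x, false) q) ∧
  (q = (a, true) → G'.Reach S (x, false) (a, true) ∧ G'.Reach S (x, false) (b, true)) ∧
  (q = (b, false) → G'.Reach S (x, false) (b, false)) ∧
  (q = (a, false) → G'.Reach S (x, false) (a, false) ∨ (G'.Reach S (x, false) (a, true) ∧
    ((b ∈ S ∧ G'.Reach S (x, false) (b, true)) ∨ (b ∉ S ∧ G'.Reach S (x, false) (b, false))))) ∧
  (q = (b, true) → (G'.Reach S (x, false) (b, true) ∧ G'.Reach S (x, false) (a, true)) ∨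
    (G'.Reach S (x, false) (b, false) ∧ (b ∉ S ∨ (a ∉ S ∧ G'.Reach S (x, false) (a, false)))))

/-- An arrival at `a` or `b` from a common parent can be made at the other end as well. Traversing
the arrow between `a` and `b` changes the arrival mark in `G'`; if that spoils the continuation to a
common parent, the step is skipped and the walk goes there directly from the end it came from. The
alternatives in `Sim` record which end remains usable. -/
theorem sim_of_reach (h : IsCoveredFlip G G' a b) {S : Set V} {x : V}
    {q : V × Bool} (hq : G.Reach S (x, false) q) : Sim G' a b x S q := by
  have hab : a ≠ b := fun e => G.irrefl a (e ▸ h.dir.1)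
  induction hq with
  | refl =>
    refine ⟨fun _ _ => .refl, fun e => by simp at e, fun e => ?_, fun e => ?_, fun e => by simp at e⟩
    · rw [← e]
    · rw [← e]; exact .inl .refl
  | @tail p q hp hpq ih =>
    obtain ⟨v, m⟩ := p
    obtain ⟨w, n⟩ := q
    obtain ⟨hadj, hn, hS⟩ := hpq
    dsimp only at hadj hn hS
    obtain ⟨i1, i2, i3, i4, i5⟩ := ih
    dsimp only [Sim] at *
    have step : ∀ {v m w n}, G'.Reach S (x, false) (v, m) → G.skeleton.Adj v w →
        (n = true ↔ G'.Dir v w) → ((m = true ∧ G'.Dir w v) ↔ v ∈ S) →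
        G'.Reach S (x, false) (w, n) := fun hr h1 h2 h3 =>
      hr.tail ⟨(h.adj_iff _ _).2 h1, h2, h3⟩
    have hdir := h.dir
    have ndir := h.dir.not_dir
    have hiff := h.dir_iff
    have hpar := h.parents
    have hnd : ∀ {u v}, G.Dir u v → ¬ G.Dir v u := fun h => h.not_dir
    have hor : ∀ {u v}, G.skeleton.Adj u v → G.Dir u v ∨ G.Dir v u := fun h' => h.dag.adj_iff.1 h'
    have hda : ∀ {u v}, G.Dir u v → G.skeleton.Adj u v := fun h => h.adj
    have hda' : ∀ {u v}, G.Dir u v → G.skeleton.Adj v u := fun h => h.adj.symm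
    have hG : ∀ {u v}, G.Dir u v → G.Dir v u → False := fun h1 h2 => h1.not_dir h2
    by_cases va : v = a
    · subst va
      have hvb := hiff v b
      by_cases wb : w = b
      · subst wb
        have hvS : v ∉ S := fun h' => ndir (hS.2 h').2
        have hn' : n = true := hn.2 hdir
        subst hn'
        have s1 := @step v false w false
        refine ⟨by grind, by grind, by grind, by grind, fun _ => ?_⟩
        cases m <;> grind
      · have wa : w ≠ v := by rintro rfl; exact G.skeleton.loopless.irrefl _ hadj
        have hw := hiff v w
        have hw' := hiff w v
        have hp := hpar w
        have hb1 := hiff w b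
        have hb2 := hiff b w
        have s1 := @step v m w n
        have s2 := @step v true w n
        have s3 := @step b true w n
        have s4 := @step b false w n
        have o := hor hadj
        have x1 := @hG v w
        have x2 := @hG b w
        have y1 := @hda' w b
        refine ⟨fun _ _ => ?_, by grind, by grind, by grind, by grind⟩
        clear hiff hpar step hor hda hda' hG hnd h
        cases m <;> cases n <;> grind
    · by_cases vb : v = b
      · subst vb
        by_cases wa : w = a
        · subst wa
          have hn' : n = false := by grind
          subst hn'
          have hv := hiff v w
          have s1 := @step v false w true
          refine ⟨by grind, by grind, by grind, fun _ => ?_, by grind⟩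
          clear hiff hpar step hor hda hda' hG hnd h
          cases m <;> grind
        · have wb : w ≠ v := by rintro rfl; exact G.skeleton.loopless.irrefl _ hadj
          have hw := hiff v w
          have hw' := hiff w v
          have hp := hpar w
          have hb1 := hiff w a
          have hb2 := hiff a w
          have s1 := @step v m w n
          have s2 := @step v false w n
          have s3 := @step a false w n
          have o := hor hadj
          have x1 := @hG v w
          have x2 := @hG a w
          have y1 := @hda' w a
          refine ⟨fun _ _ => ?_, by grind, by grind, by grind, by grind⟩
          clear hiff hpar step hor hda hda' hG hnd h
          cases m <;> cases n <;> grind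
      · have i1 := i1 va vb
        by_cases wa : w = a
        · subst wa
          have hw := hiff v w
          have hw' := hiff w v
          have hp := hpar v
          have hb1 := hiff v b
          have hb2 := hiff b v
          have s1 := @step v m w n
          have s2 := @step v m b n
          have o := hor hadj
          have x1 := @hG v w
          have x2 := @hG v b
          have y1 := @hda v b
          refine ⟨by grind, ?_, by grind, ?_, by grind⟩ <;>
          clear hiff hpar step hor hda hda' hG hnd h <;>
          cases n <;> grind
        · by_cases wb : w = b
          · subst wb
            have hw := hiff v w
            have hw' := hiff w v
            have hp := hpar v
            have hb1 := hiff v a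
            have hb2 := hiff a v
            have s1 := @step v m w n
            have s2 := @step v m a n
            have o := hor hadj
            have x1 := @hG v w
            have x2 := @hG v a
            have y1 := @hda v a
            refine ⟨by grind, by grind, ?_, by grind, ?_⟩ <;>
            clear hiff hpar step hor hda hda' hG hnd h <;>
            cases n <;> grind
          · refine ⟨fun _ _ => step i1 hadj ?_ ?_, ?_, ?_, ?_, ?_⟩ <;> grind

end IsCoveredFlip

theorem IsCoveredFlip.exists_reach {G G' : MGraph V} {a b : V} (h : IsCoveredFlip G G' a b)
    {S : Set V} {x y : V} (hr : ∃ m, G.Reach S (x, false) (y, m)) :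
    ∃ m, G'.Reach S (x, false) (y, m) := by
  obtain ⟨m, hm⟩ := hr
  obtain ⟨h1, h2, h3, h4, h5⟩ := h.sim_of_reach hm
  by_cases ya : y = a
  · subst ya
    cases m <;> grind
  · by_cases yb : y = b
    · subst yb
      cases m <;> grind
    · exact ⟨m, h1 ya yb⟩

theorem IsCoveredFlip.dSeparations_eq {G G' : MGraph V} {a b : V} (h : IsCoveredFlip G G' a b) :
    G'.dSeparations = G.dSeparations := by
  ext ⟨x, y, S⟩
  rw [h.dag.mem_dSeparations_iff, h.dag'.mem_dSeparations_iff, h.verts_eq]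
  have : (∀ m, ¬ G'.Reach S (x, false) (y, m)) ↔ ∀ m, ¬ G.Reach S (x, false) (y, m) := by
    rw [← not_exists, ← not_exists]
    exact not_congr ⟨h.symm.exists_reach, h.exists_reach⟩
  rw [this]

/-- Every covered arrow of a DAG can be reversed. -/
theorem IsDAG.exists_flip {G : MGraph V} (hG : G.IsDAG) {a b : V} (hab : G.Dir a b)
    (hcov : ∀ c, G.Dir c b ↔ G.Dir c a ∨ c = a) : ∃ G', IsCoveredFlip G G' a b := by
  classical
  have hne : a ≠ b := fun e => G.irrefl a (e ▸ hab.1)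
  let G' : MGraph V :=
    { verts := G.verts
      Edge := fun u v => (G.Dir u v ∧ ¬ (u = a ∧ v = b)) ∨ (u = b ∧ v = a)
      irrefl := by
        rintro u (h | ⟨rfl, rfl⟩)
        · exact G.irrefl u h.1.1
        · exact hne rfl
      left_mem := by
        rintro u v (h | ⟨rfl, rfl⟩)
        · exact G.left_mem _ _ h.1.1
        · exact G.right_mem _ _ hab.1
      right_mem := by
        rintro u v (h | ⟨rfl, rfl⟩)
        · exact G.right_mem _ _ h.1.1
        · exact G.left_mem _ _ hab.1 }
  have hG' : G'.IsDAG := by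
    -- Doubling the depths leaves room to put `b` just below `a` and still above the other parents
    -- of `b`, which are parents of `a`.
    refine isDAG_of_rank (fun v => if v = b then 2 * G.depth a else 2 * G.depth v + 1) ?_
    rintro u v (⟨h, h'⟩ | ⟨rfl, rfl⟩)
    · have hd := depth_lt hG.2 h
      split_ifs with h1 h2 h2
      · subst h1; subst h2; exact absurd h.1 (G.irrefl _)
      · subst h1
        have := depth_lt hG.2 hab
        omega
      · subst h2
        have hua : u ≠ a := fun e => h' ⟨e, rfl⟩
        have := depth_lt hG.2 (((hcov u).1 h).resolve_right hua)
        omega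
      · omega
    · simp [hne]
  exact ⟨G', hG, hG', rfl, hab, hcov, fun u v => by rw [← hG'.edge_iff]⟩

/-- Two different DAGs with the same skeleton and the same unshielded colliders disagree on an
arrow that is covered in the first one. -/
theorem IsDAG.exists_covered {G H : MGraph V} (hG : G.IsDAG) (hH : H.IsDAG)
    (hs : G.skeleton = H.skeleton) (hV : ∀ a c b, G.VStruct a c b ↔ H.VStruct a c b)
    (hne : ∃ a b, G.Dir a b ∧ H.Dir b a) :
    ∃ a b, G.Dir a b ∧ H.Dir b a ∧ ∀ c, G.Dir c b ↔ G.Dir c a ∨ c = a := by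
  classical
  obtain ⟨a₀, b₀, h₀⟩ := hne
  -- Among the arrows on which `G` and `H` disagree, take a head `b` of least depth and then a tail
  -- `a` of greatest depth. An uncovered arrow would give an unshielded collider of only one graph,
  -- or a disagreement contradicting one of these choices.
  obtain ⟨b, hb, hbmin⟩ := Finset.exists_min_image
    {b ∈ G.verts | ∃ a, G.Dir a b ∧ H.Dir b a} G.depth
    ⟨b₀, Finset.mem_filter.2 ⟨G.right_mem _ _ h₀.1.1, a₀, h₀⟩⟩
  obtain ⟨hbv, a₁, h₁⟩ := Finset.mem_filter.1 hb
  obtain ⟨a, ha, hamax⟩ := Finset.exists_max_image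
    {a ∈ G.verts | G.Dir a b ∧ H.Dir b a} G.depth
    ⟨a₁, Finset.mem_filter.2 ⟨G.left_mem _ _ h₁.1.1, h₁⟩⟩
  obtain ⟨hav, hab, hba⟩ := Finset.mem_filter.1 ha
  have hmin : ∀ c d, G.Dir c d → H.Dir d c → G.depth b ≤ G.depth d := fun c d h1 h2 =>
    hbmin d (Finset.mem_filter.2 ⟨G.right_mem _ _ h1.1, c, h1, h2⟩)
  have hmax : ∀ c, G.Dir c b → H.Dir b c → G.depth c ≤ G.depth a := fun c h1 h2 =>
    hamax c (Finset.mem_filter.2 ⟨G.left_mem _ _ h1.1, h1, h2⟩)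
  have hor : ∀ {u v}, G.Dir u v → H.Dir u v ∨ H.Dir v u := fun h => by
    rw [← hH.adj_iff, ← hs]; exact h.adj
  refine ⟨a, b, hab, hba, fun c => ⟨fun hcb => ?_, ?_⟩⟩
  · by_cases hca : c = a
    · exact .inr hca
    · left
      by_cases hadj : G.skeleton.Adj c a
      · rcases hG.adj_iff.1 hadj with h | h
        · exact h
        · exfalso
          have hcb' : H.Dir c b := by
            rcases hor hcb with h' | h'
            · exact h'
            · exact absurd (hmax c hcb h') (depth_lt hG.2 h).not_ge
          have hca' : H.Dir c a := hH.dir_trans hcb' hba (hs ▸ hadj)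
          exact absurd (hmin a c h hca') (depth_lt hG.2 hcb).not_ge
      · have := (hV c b a).1 ⟨hcb, hab, hca, hadj⟩
        exact absurd this.2.1 hba.not_dir
  · rintro (hca | rfl)
    · have hca' : H.Dir c a := by
        rcases hor hca with h' | h'
        · exact h'
        · exact absurd (hmin c a hca h') (depth_lt hG.2 hab).not_ge
      have hcb : c ≠ b := by rintro rfl; exact hab.not_dir hca
      have hadj : G.skeleton.Adj c b := by
        by_contra hn
        exact hab.not_dir ((hV c a b).2 ⟨hca', hba, hcb, hs ▸ hn⟩).2.1
      exact hG.dir_trans hca hab hadj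
    · exact hab

/-- Induction on the number of arrows on which `G` and `H` disagree: reversing a covered one
preserves skeleton, unshielded colliders and d-separations, and lowers the number. -/
theorem IsDAG.dSeparations_eq_of_vStruct {G H : MGraph V} (hG : G.IsDAG) (hH : H.IsDAG)
    (hv : G.verts = H.verts) (hs : G.skeleton = H.skeleton)
    (hV : ∀ a c b, G.VStruct a c b ↔ H.VStruct a c b) : G.dSeparations = H.dSeparations := by
  classical
  obtain ⟨n, hn⟩ : ∃ n, {p ∈ G.verts ×ˢ G.verts | G.Dir p.1 p.2 ∧ H.Dir p.2 p.1}.card = n := ⟨_, rfl⟩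
  induction n using Nat.strong_induction_on generalizing G with
  | _ n ih =>
    by_cases hne : ∃ a b, G.Dir a b ∧ H.Dir b a
    · obtain ⟨a, b, hab, hba, hcov⟩ := hG.exists_covered hH hs hV hne
      obtain ⟨G', hG'⟩ := hG.exists_flip hab hcov
      rw [← hG'.dSeparations_eq]
      refine ih _ ?_ hG'.dag' (hG'.verts_eq.trans hv) ?_ ?_ rfl
      · rw [← hn]
        refine Finset.card_lt_card (Finset.ssubset_iff_subset_ne.2 ⟨fun p hp => ?_, fun he => ?_⟩)
        · rw [Finset.mem_filter, hG'.verts_eq] at hp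
          refine Finset.mem_filter.2 ⟨hp.1, ?_, hp.2.2⟩
          rcases (hG'.dir_iff _ _).1 hp.2.1 with h | ⟨h, h'⟩
          · exact h.1
          · have := hp.2.2
            rw [h, h'] at this
            exact absurd this hba.not_dir
        · have : (a, b) ∈ {p ∈ G.verts ×ˢ G.verts | G.Dir p.1 p.2 ∧ H.Dir p.2 p.1} :=
            Finset.mem_filter.2 ⟨Finset.mem_product.2 ⟨G.left_mem _ _ hab.1, G.right_mem _ _ hab.1⟩,
              hab, hba⟩
          rw [← he] at this
          exact hG'.symm.dir.not_dir (Finset.mem_filter.1 this).2.1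
      · rw [← hs]
        ext u v
        exact hG'.adj_iff u v
      · intro u c w
        rw [hG'.vStruct_iff, hV]
    · rw [hG.ext_dir hH hv]
      intro a b
      constructor
      · intro h
        exact (hH.adj_iff.1 (hs ▸ h.adj)).resolve_right fun h' => hne ⟨a, b, h, h'⟩
      · intro h
        exact (hG.adj_iff.1 (hs ▸ h.adj)).resolve_right fun h' => hne ⟨b, a, h', h⟩

/-! ### Recovering the skeleton and the unshielded colliders -/

theorem dSeparations_symm {G : MGraph V} {x y : V} {S : Set V}
    (h : (x, y, S) ∈ G.dSeparations) : (y, x, S) ∈ G.dSeparations := by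
  obtain ⟨h1, h2, h3, h4, h5⟩ := h
  refine ⟨h2, h1, Ne.symm h3, ?_, fun p hp => ?_⟩
  · simpa [Set.pair_comm] using h4
  · have := h5 p.reverse hp.reverse
    rw [blocks_iff, SimpleGraph.Walk.support_reverse] at this
    rw [blocks_iff]
    exact fun h => this h.reverse

theorem not_mem_dSeparations_of_adj {G : MGraph V} {x y : V} {S : Set V}
    (h : G.skeleton.Adj x y) : (x, y, S) ∉ G.dSeparations := by
  rintro ⟨-, -, hne, -, h5⟩
  have := h5 h.toWalk (by simpa [SimpleGraph.Walk.isPath_def] using hne)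
  rw [blocks_iff] at this
  exact this (open_of_length_le (by simp))

/-- A walk that sets out downwards from a descendant of `a` and ends outside the descendants of `a`
has to turn, and its first turn is a collider. -/
theorem IsDAG.exists_collider {G : MGraph V} (hG : G.IsDAG) {a z b : V}
    (p : G.skeleton.Walk z b) (hab : ¬ G.Desc a b) :
    ∀ t, G.Desc a t → G.Dir t z → ∃ u c w, [u, c, w] <:+: t :: p.support ∧
      G.Dir u c ∧ G.Dir w c ∧ Relation.TransGen G.Dir a c := by
  induction p with
  | nil => exact fun t h1 h2 => absurd (h1.tail h2) hab
  | @cons z w b hzw q ih =>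
    intro t h1 h2
    rcases hG.adj_iff.1 hzw with h | h
    · obtain ⟨u, c, v, hi, hr⟩ := ih hab z (h1.tail h2) h
      refine ⟨u, c, v, ?_, hr⟩
      rw [SimpleGraph.Walk.support_cons]
      exact List.infix_cons_iff.2 (.inr hi)
    · refine ⟨t, z, w, ?_, h2, h, .tail' h1 h2⟩
      rw [SimpleGraph.Walk.support_cons, ← SimpleGraph.Walk.cons_tail_support q]
      exact (List.prefix_append [t, z, w] _).isInfix

/-- The local Markov property. A path that leaves `a` through a parent is blocked there. One that
leaves through a child meets a collider strictly below `a`, none of whose descendants is a parent of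
`a` by acyclicity. -/
theorem IsDAG.parents_separate {G : MGraph V} (hG : G.IsDAG) {a b : V} (ha : a ∈ G.verts)
    (hb : b ∈ G.verts) (hne : a ≠ b) (hadj : ¬ G.skeleton.Adj a b) (hab : ¬ G.Desc a b) :
    (a, b, {z | G.Dir z a}) ∈ G.dSeparations := by
  refine ⟨ha, hb, hne, fun z hz => ⟨G.left_mem _ _ hz.1, ?_⟩, fun p _ => ?_⟩
  · rintro (rfl | rfl)
    · exact G.irrefl _ hz.1
    · exact hadj hz.adj.symm
  · cases p with
    | nil => exact absurd rfl hne
    | @cons _ z _ haz q =>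
      rw [blocks_iff]
      intro ho
      rw [SimpleGraph.Walk.support_cons] at ho
      rcases hG.adj_iff.1 haz with h | h
      · obtain ⟨u, c, w, hi, h1, h2, h3⟩ := hG.exists_collider q hab a .refl h
        refine ho u c w hi (.inr ⟨⟨h1, h2⟩, fun d hd hda => ?_⟩)
        exact hG.2 a ((h3.trans_left hd).tail hda)
      · cases q with
        | nil => exact hadj haz
        | @cons _ w _ hzw q =>
          rw [SimpleGraph.Walk.support_cons, ← SimpleGraph.Walk.cons_tail_support q] at ho
          refine (open_cons_cons_cons.1 ho).1 (.inl ⟨?_, h⟩)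
          rcases hG.adj_iff.1 hzw with h' | h'
          · exact .inr (.inr ⟨h, h'⟩)
          · exact .inr (.inl ⟨h, h'⟩)

/-- Of two distinct vertices one is not a descendant of the other, so `parents_separate` applies in
one of the two orders. -/
theorem IsDAG.adj_iff_dSeparations {G : MGraph V} (hG : G.IsDAG) {a b : V} :
    G.skeleton.Adj a b ↔
      a ∈ G.verts ∧ b ∈ G.verts ∧ a ≠ b ∧ ∀ S, (a, b, S) ∉ G.dSeparations := by
  constructor
  · intro h
    refine ⟨?_, ?_, h.ne, fun S => not_mem_dSeparations_of_adj h⟩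
    · exact h.elim (G.left_mem _ _) (G.right_mem _ _)
    · exact h.elim (G.right_mem _ _) (G.left_mem _ _)
  · rintro ⟨ha, hb, hne, hS⟩
    by_contra hadj
    by_cases hab : G.Desc a b
    · have hba : ¬ G.Desc b a := fun hba => by
        rcases Relation.reflTransGen_iff_eq_or_transGen.1 hab with h | h
        · exact hne h.symm
        · exact hG.2 a (h.trans_left hba)
      exact hS _ (dSeparations_symm
        (hG.parents_separate hb ha hne.symm (fun h => hadj h.symm) hba))
    · exact hS _ (hG.parents_separate ha hb hne hadj hab)

/-- A set separating `a` and `b` must block the path `a, c, b`. In `G` this excludes `c` from the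
set; in `H` a path blocked without `c` in the set must have a collider at `c`. -/
theorem IsDAG.vStruct_of_dSeparations {G H : MGraph V} (hG : G.IsDAG) (hH : H.IsDAG)
    (hs : G.skeleton = H.skeleton)
    (h : G.dSeparations = H.dSeparations) {a c b : V} (hV : G.VStruct a c b) :
    H.VStruct a c b := by
  obtain ⟨hac, hbc, hne, hadj⟩ := hV
  obtain ⟨S, hS⟩ : ∃ S, (a, b, S) ∈ G.dSeparations := by
    by_contra hS
    push Not at hS
    exact hadj (hG.adj_iff_dSeparations.2 ⟨G.left_mem _ _ hac.1, G.left_mem _ _ hbc.1, hne, hS⟩)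
  have key : ∀ {K : MGraph V}, K.IsDAG → K.skeleton = G.skeleton → (a, b, S) ∈ K.dSeparations →
      K.BlockedAt S a c b := by
    intro K hK hKs hKS
    have h1 : K.skeleton.Adj a c := hKs ▸ hac.adj
    have h2 : K.skeleton.Adj c b := hKs ▸ hbc.adj.symm
    have := hKS.2.2.2.2 (.cons h1 (.cons h2 .nil)) (by
      simp [SimpleGraph.Walk.isPath_def, hne, h1.ne, h2.ne])
    rw [blocks_iff] at this
    by_contra hb
    exact this (open_cons_cons_cons.2 ⟨hb, open_of_length_le (by simp)⟩)
  have hcS : c ∉ S := by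
    rcases key hG rfl hS with h' | h'
    · have := hac.not_dir
      have := hbc.not_dir
      tauto
    · exact h'.2 c .refl
  rcases key hH hs.symm (h ▸ hS) with h' | h'
  · exact absurd h'.2 hcS
  · exact ⟨h'.1.1, h'.1.2, hne, hs ▸ hadj⟩

/-- Two DAGs on the same vertices are Markov equivalent if and only if they have the same skeleton
and the same unshielded colliders. -/
theorem IsDAG.mem_markovClass_iff {G H : MGraph V} (hG : G.IsDAG) :
    H ∈ G.markovClass ↔ H.IsDAG ∧ H.verts = G.verts ∧ H.skeleton = G.skeleton ∧
      ∀ a c b, H.VStruct a c b ↔ G.VStruct a c b := by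
  constructor
  · rintro ⟨hH, hv, hd⟩
    have hs : H.skeleton = G.skeleton := by
      ext a b
      rw [hH.adj_iff_dSeparations, hG.adj_iff_dSeparations, hv, hd]
    exact ⟨hH, hv, hs, fun a c b => ⟨hH.vStruct_of_dSeparations hG hs hd,
      hG.vStruct_of_dSeparations hH hs.symm hd.symm⟩⟩
  · rintro ⟨hH, hv, hs, hV⟩
    exact ⟨hH, hv, hH.dSeparations_eq_of_vStruct hG hv hs hV⟩

/-! ### Extensions of partially directed graphs -/

/-- The DAGs obtained from `L` by orienting its undirected edges without new unshielded
colliders. -/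
def extensions (L : MGraph V) : Set (MGraph V) :=
  {G | G.IsDAG ∧ G.verts = L.verts ∧ G.skeleton = L.skeleton ∧
    (∀ a b, G.Edge a b → L.Edge a b) ∧ ∀ a c b, G.VStruct a c b → L.Dir a c ∧ L.Dir b c}

/-- `L` has an extension, and an arrow `a → b` propagates along an undirected edge `b - c`. -/
structure IsExtendable (L : MGraph V) : Prop where
  dir_of_undir : ∀ a b c, L.Dir a b → L.Undir b c → L.Dir a c
  nonempty : L.extensions.Nonempty

theorem Undir.symm {L : MGraph V} {a b : V} (h : L.Undir a b) : L.Undir b a := ⟨h.2, h.1⟩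

theorem Undir.adj {L : MGraph V} {a b : V} (h : L.Undir a b) : L.skeleton.Adj a b := .inl h.1

theorem Dir.not_undir {L : MGraph V} {a b : V} (h : L.Dir a b) : ¬ L.Undir a b := fun h' => h.2 h'.2

theorem skeleton_adj_iff {L : MGraph V} {a b : V} :
    L.skeleton.Adj a b ↔ L.Dir a b ∨ L.Dir b a ∨ L.Undir a b := by
  change L.Edge a b ∨ L.Edge b a ↔ _
  unfold Dir Undir
  tauto

theorem edge_iff_dir_or_undir {L : MGraph V} {a b : V} :
    L.Edge a b ↔ L.Dir a b ∨ L.Undir a b := by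
  unfold Dir Undir
  tauto

theorem VStruct.symm {G : MGraph V} {a c b : V} (h : G.VStruct a c b) : G.VStruct b c a :=
  ⟨h.2.1, h.1, h.2.2.1.symm, fun h' => h.2.2.2 h'.symm⟩

theorem dir_of_mem_extensions {L G : MGraph V} (hG : G ∈ L.extensions) {a b : V}
    (h : L.Dir a b) : G.Dir a b := by
  obtain ⟨hd, -, hs, he, -⟩ := hG
  rcases hd.adj_iff.1 (hs ▸ h.adj) with h' | h'
  · exact h'
  · exact absurd (he _ _ h'.1) h.2

theorem dir_acyclic_of_mem_extensions {L G : MGraph V} (hG : G ∈ L.extensions) (a : V) :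
    ¬ Relation.TransGen L.Dir a a := fun h =>
  hG.1.2 a (h.lift id fun _ _ h => dir_of_mem_extensions hG h)

namespace IsExtendable

/-- Within the undirected part, the parents of a vertex in an extension are joined by undirected
edges. -/
theorem undir_of_dir {L G : MGraph V} (hL : L.IsExtendable) (hG : G ∈ L.extensions) {a b c : V}
    (hac : L.Undir a c) (hbc : L.Undir b c) (hac' : G.Dir a c) (hbc' : G.Dir b c) (hab : a ≠ b) :
    L.Undir a b := by
  have hadj : L.skeleton.Adj a b := by
    by_contra hn
    exact (hG.2.2.2.2 a c b ⟨hac', hbc', hab, hG.2.2.1 ▸ hn⟩).1.not_undir hac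
  rcases skeleton_adj_iff.1 hadj with h | h | h
  · exact absurd hac (hL.dir_of_undir a b c h hbc).not_undir
  · exact absurd hbc (hL.dir_of_undir b a c h hac).not_undir
  · exact h

theorem transGen_of_undir {L : MGraph V}
    (hflag : ∀ a b c, L.Dir a b → L.Undir b c → L.Dir a c) {u v w : V}
    (h : Relation.TransGen L.Dir u v) (hvw : L.Undir v w) : Relation.TransGen L.Dir u w := by
  cases h with
  | single h => exact .single (hflag _ _ _ h hvw)
  | tail h h' => exact h.tail (hflag _ _ _ h' hvw)

/-- Depth in the directed part is thus constant on chain components, so it can be combined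
lexicographically with any ranking inside them. -/
theorem depth_eq {L : MGraph V} (hL : L.IsExtendable) {a b : V} (hab : L.Undir a b) :
    L.depth a = L.depth b := by
  classical
  unfold depth
  congr 1
  ext u
  simp only [Finset.mem_filter]
  exact and_congr_right fun _ => ⟨fun h => transGen_of_undir hL.dir_of_undir h hab,
    fun h => transGen_of_undir hL.dir_of_undir h hab.symm⟩

/-- Orienting the undirected part along a ranking that makes it moral gives an extension. -/
theorem exists_extension_of_rank {L : MGraph V} (hL : L.IsExtendable) (f : V → ℕ)
    (hne : ∀ a b, L.Undir a b → f a ≠ f b)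
    (hf : ∀ a c b, L.Undir a c → L.Undir b c → f a < f c → f b < f c → a ≠ b → L.Undir a b) :
    ∃ D ∈ L.extensions, ∀ a b, L.Undir a b → f a < f b → D.Dir a b := by
  obtain ⟨G, hG⟩ := hL.nonempty
  let D : MGraph V :=
    { verts := L.verts
      Edge := fun a b => L.Dir a b ∨ (L.Undir a b ∧ f a < f b)
      irrefl := by
        rintro a (h | h)
        · exact L.irrefl a h.1
        · exact L.irrefl a h.1.1
      left_mem := by
        rintro a b (h | h)
        · exact L.left_mem _ _ h.1
        · exact L.left_mem _ _ h.1.1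
      right_mem := by
        rintro a b (h | h)
        · exact L.right_mem _ _ h.1
        · exact L.right_mem _ _ h.1.1 }
  have hD : D.IsDAG := by
    refine isDAG_of_rank (fun v => toLex (L.depth v, f v)) ?_
    rintro a b (h | h)
    · exact Prod.Lex.toLex_lt_toLex.2 (.inl (depth_lt (dir_acyclic_of_mem_extensions hG) h))
    · exact Prod.Lex.toLex_lt_toLex.2 (.inr ⟨hL.depth_eq h.1, h.2⟩)
  have hs : D.skeleton = L.skeleton := by
    ext a b
    rw [skeleton_adj_iff (L := L)]
    change (L.Dir a b ∨ (L.Undir a b ∧ f a < f b)) ∨ (L.Dir b a ∨ (L.Undir b a ∧ f b < f a)) ↔ _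
    constructor
    · rintro ((h | h) | (h | h))
      exacts [.inl h, .inr (.inr h.1), .inr (.inl h), .inr (.inr h.1.symm)]
    · rintro (h | h | h)
      · exact .inl (.inl h)
      · exact .inr (.inl h)
      · rcases lt_or_gt_of_ne (hne a b h) with h' | h'
        · exact .inl (.inr ⟨h, h'⟩)
        · exact .inr (.inr ⟨h.symm, h'⟩)
  refine ⟨D, ⟨hD, rfl, hs, ?_, ?_⟩, fun a b h h' => hD.1 _ _ (.inr ⟨h, h'⟩)⟩
  · rintro a b (h | h)
    exacts [h.1, h.1.1]
  · rintro a c b ⟨⟨hac, -⟩, ⟨hbc, -⟩, hab, hn⟩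
    rw [hs] at hn
    rcases hac with hac | hac <;> rcases hbc with hbc | hbc
    · exact ⟨hac, hbc⟩
    · exact absurd (hL.dir_of_undir _ _ _ hac hbc.1.symm).adj hn
    · exact absurd (hL.dir_of_undir _ _ _ hbc hac.1.symm).adj.symm hn
    · exact absurd (hf a c b hac.1 hbc.1 hac.2 hbc.2 hab).adj hn

end IsExtendable

/-! ### Simplicial vertices -/

/-- `v` is a simplicial vertex of the subgraph of `T` induced on `B`. -/
def Simplicial (T : SimpleGraph V) (B : Finset V) (v : V) : Prop :=
  v ∈ B ∧ ∀ b ∈ B, ∀ c ∈ B, T.Adj v b → T.Adj v c → b ≠ c → T.Adj b c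

-- Dirac's theorem on chordal graphs. Delete a simplicial vertex `v`: two non-adjacent simplicial
-- vertices of the rest are not both neighbours of `v`, and one that is not a neighbour stays
-- simplicial and pairs with `v`.
open Classical in
theorem complete_or_two_simplicial {T : SimpleGraph V} {A : Finset V}
    (hA : ∀ B ⊆ A, B.Nonempty → ∃ v, Simplicial T B v) : ∀ B ⊆ A,
      (∀ a ∈ B, ∀ b ∈ B, a ≠ b → T.Adj a b) ∨
      ∃ a b, a ≠ b ∧ ¬ T.Adj a b ∧ Simplicial T B a ∧ Simplicial T B b := by
  intro B
  induction B using Finset.strongInduction with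
  | _ B ih =>
    intro hB
    rcases B.eq_empty_or_nonempty with rfl | hne
    · simp
    · obtain ⟨v, hv⟩ := hA B hB hne
      have extend : ∀ a, a ≠ v → ¬ T.Adj a v → Simplicial T (B.erase v) a →
          Simplicial T B a := by
        intro a _ hadj ha
        refine ⟨Finset.mem_of_mem_erase ha.1, fun b hb c hc hab hac => ?_⟩
        have hbv : b ≠ v := by rintro rfl; exact hadj hab
        have hcv : c ≠ v := by rintro rfl; exact hadj hac
        exact ha.2 b (Finset.mem_erase.2 ⟨hbv, hb⟩) c (Finset.mem_erase.2 ⟨hcv, hc⟩) hab hac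
      rcases ih _ (Finset.erase_ssubset hv.1) ((Finset.erase_subset _ _).trans hB) with h | h
      · by_cases hall : ∀ a ∈ B, a ≠ v → T.Adj a v
        · left
          intro a ha b hb hab
          by_cases hav : a = v
          · subst hav; exact (hall b hb hab.symm).symm
          · by_cases hbv : b = v
            · subst hbv; exact hall a ha hab
            · exact h a (Finset.mem_erase.2 ⟨hav, ha⟩) b (Finset.mem_erase.2 ⟨hbv, hb⟩) hab
        · push Not at hall
          obtain ⟨a, ha, hav, hadj⟩ := hall
          refine .inr ⟨a, v, hav, hadj, extend a hav hadj ⟨Finset.mem_erase.2 ⟨hav, ha⟩, ?_⟩, hv⟩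
          exact fun b hb c hc _ _ hbc => h b hb c hc hbc
      · obtain ⟨a, b, hab, hadj, ha, hb⟩ := h
        right
        have hav := Finset.mem_erase.1 ha.1
        have hbv := Finset.mem_erase.1 hb.1
        by_cases h1 : T.Adj a v
        · by_cases h2 : T.Adj b v
          · exact absurd (hv.2 a hav.2 b hbv.2 h1.symm h2.symm hab) hadj
          · exact ⟨b, v, hbv.1, h2, extend b hbv.1 h2 hb, hv⟩
        · exact ⟨a, v, hav.1, h1, extend a hav.1 h1 ha, hv⟩

open Classical in
/-- A graph whose induced subgraphs have simplicial vertices has a perfect elimination ordering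
that starts at any given vertex. -/
theorem exists_rank_of_simplicial {T : SimpleGraph V} {A : Finset V}
    (hA : ∀ B ⊆ A, B.Nonempty → ∃ v, Simplicial T B v) {x : V} : ∀ B ⊆ A, x ∈ B →
      ∃ f : V → ℕ, Set.InjOn f B ∧ (∀ b ∈ B, f x ≤ f b) ∧ (∀ b ∈ B, f b < B.card) ∧
        ∀ a ∈ B, ∀ b ∈ B, ∀ c ∈ B, T.Adj a c → T.Adj b c → f a < f c → f b < f c → a ≠ b →
          T.Adj a b := by
  intro B
  induction B using Finset.strongInduction with
  | _ B ih =>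
    intro hB hx
    by_cases hsing : ∃ y ∈ B, y ≠ x
    · obtain ⟨v, hv, hvx⟩ : ∃ v, Simplicial T B v ∧ v ≠ x := by
        rcases complete_or_two_simplicial hA B hB with h | ⟨a, b, hab, -, ha, hb⟩
        · obtain ⟨y, hy, hyx⟩ := hsing
          exact ⟨y, ⟨hy, fun b hb c hc _ _ hbc => h b hb c hc hbc⟩, hyx⟩
        · by_cases hax : a = x
          · exact ⟨b, hb, fun h => hab (hax.trans h.symm)⟩
          · exact ⟨a, ha, hax⟩
      obtain ⟨f, h1, h2, h3, h4⟩ := ih _ (Finset.erase_ssubset hv.1)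
        ((Finset.erase_subset _ _).trans hB) (Finset.mem_erase.2 ⟨hvx.symm, hx⟩)
      have hcard := Finset.card_erase_add_one hv.1
      have hlt : ∀ b ∈ B, b ≠ v → f b < (B.erase v).card := fun b hb hbv =>
        h3 b (Finset.mem_erase.2 ⟨hbv, hb⟩)
      -- The simplicial vertex `v ≠ x` is ranked last; its earlier neighbours are pairwise adjacent.
      refine ⟨Function.update f v (B.erase v).card, ?_, ?_, ?_, ?_⟩
      · intro a ha b hb hab
        by_cases hav : a = v <;> by_cases hbv : b = v
        · rw [hav, hbv]
        · subst hav
          have := hlt b hb hbv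
          simp [Function.update_of_ne hbv] at hab
          omega
        · subst hbv
          have := hlt a ha hav
          simp [Function.update_of_ne hav] at hab
          omega
        · rw [Function.update_of_ne hav, Function.update_of_ne hbv] at hab
          exact h1 (Finset.mem_coe.2 (Finset.mem_erase.2 ⟨hav, ha⟩))
            (Finset.mem_coe.2 (Finset.mem_erase.2 ⟨hbv, hb⟩)) hab
      · intro b hb
        rw [Function.update_of_ne hvx.symm]
        by_cases hbv : b = v
        · subst hbv
          simpa using (hlt x hx hvx.symm).le
        · rw [Function.update_of_ne hbv]
          exact h2 b (Finset.mem_erase.2 ⟨hbv, hb⟩)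
      · intro b hb
        by_cases hbv : b = v
        · subst hbv
          simp; omega
        · rw [Function.update_of_ne hbv]
          have := hlt b hb hbv
          omega
      · intro a ha b hb c hc hac hbc hfa hfb hab
        by_cases hcv : c = v
        · subst hcv
          exact hv.2 a ha b hb hac.symm hbc.symm hab
        · rw [Function.update_of_ne hcv] at hfa hfb
          have hcl := hlt c hc hcv
          have hav : a ≠ v := by rintro rfl; simp at hfa; omega
          have hbv : b ≠ v := by rintro rfl; simp at hfb; omega
          rw [Function.update_of_ne hav] at hfa
          rw [Function.update_of_ne hbv] at hfb
          exact h4 a (Finset.mem_erase.2 ⟨hav, ha⟩) b (Finset.mem_erase.2 ⟨hbv, hb⟩) c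
            (Finset.mem_erase.2 ⟨hcv, hc⟩) hac hbc hfa hfb hab
    · push Not at hsing
      refine ⟨fun _ => 0, ?_, by simp, fun _ _ => Finset.card_pos.2 ⟨x, hx⟩, by simp⟩
      intro a ha b hb _
      rw [hsing a ha, hsing b hb]

namespace IsExtendable

/-- Every vertex comes first among its undirected neighbours in some extension. -/
theorem exists_extension_rooted {L : MGraph V} (hL : L.IsExtendable) (x : V) :
    ∃ D ∈ L.extensions, ∀ b, L.Undir x b → D.Dir x b := by
  classical
  by_cases hx : x ∈ L.verts
  · obtain ⟨G, hG⟩ := hL.nonempty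
    -- The deepest vertex of `B` in an extension `G` is simplicial: all its undirected neighbours in
    -- `B` are parents of it in `G`.
    obtain ⟨f, h1, h2, -, h4⟩ := exists_rank_of_simplicial (T := L.undirPart) (A := L.verts)
      (fun B _ hne => by
        obtain ⟨v, hv, hmax⟩ := Finset.exists_max_image B G.depth hne
        refine ⟨v, hv, fun b hb c hc hvb hvc hbc => ?_⟩
        have into : ∀ b ∈ B, L.Undir v b → G.Dir b v := by
          intro b hb h
          rcases hG.1.adj_iff.1 (hG.2.2.1 ▸ h.adj : G.skeleton.Adj v b) with h' | h'
          · exact absurd (hmax b hb) (depth_lt hG.1.2 h').not_ge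
          · exact h'
        exact hL.undir_of_dir hG (Undir.symm hvb) (Undir.symm hvc) (into b hb hvb) (into c hc hvc)
          hbc) L.verts subset_rfl hx
    obtain ⟨D, hD, hD'⟩ := hL.exists_extension_of_rank f
      (fun a b h h' => L.undirPart.ne_of_adj h
        (h1 (L.left_mem _ _ h.1) (L.right_mem _ _ h.1) h'))
      (fun a c b hac hbc => h4 a (L.left_mem _ _ hac.1) b (L.left_mem _ _ hbc.1) c
        (L.right_mem _ _ hac.1) hac hbc)
    refine ⟨D, hD, fun b hb => hD' x b hb (lt_of_le_of_ne (h2 b (L.right_mem _ _ hb.1)) ?_)⟩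
    exact fun h' => L.undirPart.ne_of_adj hb (h1 hx (L.right_mem _ _ hb.1) h')
  · obtain ⟨G, hG⟩ := hL.nonempty
    exact ⟨G, hG, fun b hb => absurd (L.left_mem _ _ hb.1) hx⟩

/-- An undirected edge occurs in both directions because either end can be made first. -/
theorem edge_iff {L : MGraph V} (hL : L.IsExtendable) {a b : V} :
    L.Edge a b ↔ ∃ G ∈ L.extensions, G.Edge a b := by
  constructor
  · intro h
    rcases edge_iff_dir_or_undir.1 h with h | h
    · obtain ⟨G, hG⟩ := hL.nonempty
      exact ⟨G, hG, (dir_of_mem_extensions hG h).1⟩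
    · obtain ⟨D, hD, h'⟩ := hL.exists_extension_rooted a
      exact ⟨D, hD, (h' b h).1⟩
  · rintro ⟨G, hG, h⟩
    exact hG.2.2.2.1 _ _ h

end IsExtendable

/-! ### Orientation rules -/

/-- The arrows that are forced by the arrows in `B` in an acyclic orientation of `A` all of whose
unshielded colliders consist of arrows in `B`. -/
inductive Forced (A : SimpleGraph V) (B : V → V → Prop) : V → V → Prop
  | base {a b : V} : B a b → Forced A B a b
  | away {d a b : V} : Forced A B d a → A.Adj a b → ¬ A.Adj d b → d ≠ b → ¬ B b a → Forced A B a b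
  | trans {a d b : V} : Forced A B a d → Forced A B d b → A.Adj a b → Forced A B a b
  | fork {a d e b : V} : A.Adj a d → A.Adj a e → Forced A B d b → Forced A B e b → ¬ A.Adj d e →
      d ≠ e → ¬ B d a → A.Adj a b → Forced A B a b

/-- The acyclic orientations of `A` that contain `B` and all of whose unshielded colliders consist
of arrows in `B`. -/
def orientations (W : Finset V) (A : SimpleGraph V) (B : V → V → Prop) : Set (MGraph V) :=
  {G | G.IsDAG ∧ G.verts = W ∧ G.skeleton = A ∧ (∀ a b, B a b → G.Dir a b) ∧
    ∀ a c b, G.VStruct a c b → B a c}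

/-- Soundness of the rules: the opposite arrow would close a directed cycle or complete an
unshielded collider containing an arrow outside `B`. -/
theorem Forced.dir {W : Finset V} {A : SimpleGraph V} {B : V → V → Prop} {G : MGraph V}
    (hG : G ∈ orientations W A B) {a b : V} (h : Forced A B a b) : G.Dir a b := by
  obtain ⟨hd, -, rfl, hB, hV⟩ := hG
  induction h with
  | base h => exact hB _ _ h
  | @away d a b _ hab hdb hne hn ih =>
    refine (hd.adj_iff.1 hab).resolve_right fun h => hn ?_
    exact hV b a d ⟨h, ih, hne.symm, fun h => hdb h.symm⟩
  | trans _ _ hab ih1 ih2 => exact hd.dir_trans ih1 ih2 hab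
  | @fork a d e b had hae _ _ hde hne hn hab ih1 ih2 =>
    refine (hd.adj_iff.1 hab).resolve_right fun h => hn ?_
    exact hV d a e ⟨hd.dir_trans ih1 h had.symm, hd.dir_trans ih2 h hae.symm, hne, hde⟩

/-- A forced arrow `a → b` propagates along an edge `b - c` that is not forced. -/
theorem Forced.propagate {A : SimpleGraph V} {B : V → V → Prop}
    (hB : ∀ a b, B a b → (∃ d, B d b ∧ a ≠ d ∧ ¬ A.Adj a d) ∨ ∀ c, A.Adj a c → B a c)
    {a b : V} (h : Forced A B a b) : ∀ c, A.Adj b c → ¬ Forced A B b c → ¬ Forced A B c b →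
      Forced A B a c := by
  have adj : ∀ {a b c : V}, Forced A B a b → A.Adj b c → ¬ Forced A B b c → ¬ Forced A B c b →
      A.Adj a c := by
    intro a b c h hbc h1 h2
    by_contra hn
    have hac : a ≠ c := by rintro rfl; exact h2 h
    exact h1 (.away h hbc hn hac fun h' => h2 (.base h'))
  induction h with
  | @base a b h =>
    intro c hbc h1 h2
    have hac := adj (.base h) hbc h1 h2
    rcases hB a b h with ⟨d, hd, hne, hn⟩ | h'
    · by_contra hcon
      have hdc := adj (.base hd) hbc h1 h2
      -- If `B a c` fails, `c` cannot be a collider of `a` and `d`, so `fork` would force `c → b`.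
      exact h2 (.fork hac.symm hdc.symm (.base h) (.base hd) hn hne
        (fun h' => hcon (.base h')) hbc.symm)
    · exact .base (h' c hac)
  | @away d a b hda hab hdb hne hn ih =>
    intro c hbc h1 h2
    have hF : Forced A B a b := .away hda hab hdb hne hn
    have hac := adj hF hbc h1 h2
    by_contra hcon
    have hca : ¬ Forced A B c a := fun h => h2 (.trans h hF hbc.symm)
    -- If `a → c` is not forced, neither is `c → a`, so `d → c` is forced by induction; as `d` and
    -- `b` are not adjacent, this would force `c → b`.
    exact h2 (.away (ih c hac hcon hca) hbc.symm hdb hne fun h => h1 (.base h))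
  | @trans a d b had hdb hab _ ih2 =>
    intro c hbc h1 h2
    exact .trans had (ih2 c hbc h1 h2) (adj (.trans had hdb hab) hbc h1 h2)
  | @fork a d e b had hae hdb heb hde hne hn hab ih1 ih2 =>
    intro c hbc h1 h2
    exact .fork had hae (ih1 c hbc h1 h2) (ih2 c hbc h1 h2) hde hne hn
      (adj (.fork had hae hdb heb hde hne hn hab) hbc h1 h2)

/-- The union of all orientations is extendable, and its extensions are these orientations. -/
theorem isExtendable_of_union {W : Finset V} {A : SimpleGraph V} {B : V → V → Prop}
    (hB : ∀ a b, B a b → (∃ d, B d b ∧ a ≠ d ∧ ¬ A.Adj a d) ∨ ∀ c, A.Adj a c → B a c)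
    (hne : (orientations W A B).Nonempty) {K : MGraph V} (hW : K.verts = W)
    (hK : ∀ a b, K.Edge a b ↔ ∃ G ∈ orientations W A B, G.Edge a b) :
    K.IsExtendable ∧ K.extensions = orientations W A B := by
  obtain ⟨G₀, hG₀⟩ := hne
  have hadj : ∀ {a b}, Forced A B a b → A.Adj a b := fun h => hG₀.2.2.1 ▸ (h.dir hG₀).adj
  have hasymm : ∀ {a b}, Forced A B a b → ¬ Forced A B b a := fun h h' =>
    (h.dir hG₀).not_dir (h'.dir hG₀)
  have hmem : ∀ {a b}, A.Adj a b → a ∈ W ∧ b ∈ W := by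
    obtain ⟨-, rfl, rfl, -⟩ := hG₀
    rintro a b (h | h)
    · exact ⟨G₀.left_mem _ _ h, G₀.right_mem _ _ h⟩
    · exact ⟨G₀.right_mem _ _ h, G₀.left_mem _ _ h⟩
  let L : MGraph V :=
    { verts := W
      Edge := fun a b => A.Adj a b ∧ ¬ Forced A B b a
      irrefl := fun a h => A.loopless.irrefl a h.1
      left_mem := fun a b h => (hmem h.1).1
      right_mem := fun a b h => (hmem h.1).2 }
  have hDir : ∀ {a b}, L.Dir a b ↔ Forced A B a b := by
    intro a b
    constructor
    · rintro ⟨h1, h2⟩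
      by_contra hn
      exact h2 ⟨h1.1.symm, hn⟩
    · intro h
      exact ⟨⟨hadj h, hasymm h⟩, fun h' => h'.2 h⟩
  have hskel : L.skeleton = A := by
    ext a b
    constructor
    · rintro (h | h)
      exacts [h.1, h.1.symm]
    · intro h
      by_cases h' : Forced A B b a
      · exact .inr ⟨h.symm, hasymm h'⟩
      · exact .inl ⟨h, h'⟩
  have hext : L.extensions = orientations W A B := by
    ext G
    constructor
    · intro hG
      refine ⟨hG.1, hG.2.1, hG.2.2.1.trans hskel, fun a b h =>
        dir_of_mem_extensions hG (hDir.2 (.base h)), fun a c b h => ?_⟩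
      have := hG.2.2.2.2 a c b h
      refine hG₀.2.2.2.2 a c b ⟨(hDir.1 this.1).dir hG₀, (hDir.1 this.2).dir hG₀, h.2.2.1, ?_⟩
      rw [hG₀.2.2.1, ← hskel, ← hG.2.2.1]
      exact h.2.2.2
    · intro hG
      refine ⟨hG.1, hG.2.1, hG.2.2.1.trans hskel.symm, fun a b h => ⟨?_, fun h' => ?_⟩,
        fun a c b h => ⟨hDir.2 (.base (hG.2.2.2.2 _ _ _ h)),
          hDir.2 (.base (hG.2.2.2.2 _ _ _ h.symm))⟩⟩
      · rw [← hG.2.2.1]; exact .inl h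
      · exact (h'.dir hG).2 h
  have hL : L.IsExtendable := by
    refine ⟨fun a b c h1 h2 => hDir.2 ?_, hext ▸ ⟨G₀, hG₀⟩⟩
    exact (hDir.1 h1).propagate hB c h2.1.1 h2.2.2 h2.1.2
  -- Completeness of the rules: `L`, which orients the forced edges only, is extendable and hence
  -- the union of its extensions, as `K` is by hypothesis.
  obtain rfl : K = L := by
    ext a b
    · rw [hW]
    · rw [hK, hL.edge_iff, hext]
  exact ⟨hL, hext⟩

/-! ### Essential graphs -/

theorem IsDAG.mem_markovClass_self {G : MGraph V} (hG : G.IsDAG) : G ∈ G.markovClass :=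
  ⟨hG, rfl, rfl⟩

theorem IsDAG.markovClass_eq_orientations {G : MGraph V} (hG : G.IsDAG) :
    G.markovClass = orientations G.verts G.skeleton fun a b => ∃ d, G.VStruct a b d := by
  ext H
  rw [hG.mem_markovClass_iff]
  constructor
  · rintro ⟨hH, hv, hs, hV⟩
    exact ⟨hH, hv, hs, fun a b ⟨d, h⟩ => ((hV _ _ _).2 h).1, fun a c b h => ⟨b, (hV _ _ _).1 h⟩⟩
  · rintro ⟨hH, hv, hs, hB, hV⟩
    refine ⟨hH, hv, hs, fun a c b => ⟨fun h => ?_, fun h => ?_⟩⟩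
    · obtain ⟨d, hd⟩ := hV a c b h
      obtain ⟨e, he⟩ := hV b c a h.symm
      exact ⟨hd.1, he.1, h.2.2.1, hs ▸ h.2.2.2⟩
    · exact ⟨hB _ _ ⟨b, h⟩, hB _ _ ⟨a, h.symm⟩, h.2.2.1, hs ▸ h.2.2.2⟩

theorem IsDAG.essentialGraph_isExtendable {G : MGraph V} (hG : G.IsDAG) :
    G.essentialGraph.IsExtendable ∧ G.essentialGraph.extensions = G.markovClass := by
  have h := hG.markovClass_eq_orientations
  obtain ⟨h1, h2⟩ := isExtendable_of_union (W := G.verts) (A := G.skeleton)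
    (B := fun a b => ∃ d, G.VStruct a b d) (K := G.essentialGraph)
    (fun a b ⟨d, hd⟩ => .inl ⟨d, ⟨a, hd.symm⟩, hd.2.2⟩)
    (h ▸ ⟨G, hG.mem_markovClass_self⟩) rfl (fun a b => by rw [← h]; rfl)
  exact ⟨h1, h2.trans h.symm⟩

theorem IsEssential.isExtendable {K : MGraph V} (hK : K.IsEssential) : K.IsExtendable := by
  obtain ⟨G, hG, rfl⟩ := hK
  exact hG.essentialGraph_isExtendable.1

theorem IsEssential.mec_eq {K : MGraph V} (hK : K.IsEssential) : K.mec = K.extensions := by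
  obtain ⟨G, hG, rfl⟩ := hK
  ext H
  constructor
  · rintro ⟨hH, h⟩
    rw [← h, hH.essentialGraph_isExtendable.2]
    exact hH.mem_markovClass_self
  · rw [hG.essentialGraph_isExtendable.2]
    rintro ⟨hH, hv, hd⟩
    refine ⟨hH, ?_⟩
    have : H.markovClass = G.markovClass := by
      unfold markovClass
      rw [hv, hd]
    ext a b
    · exact Finset.ext_iff.1 hv a
    · change (∃ G' ∈ H.markovClass, G'.Edge a b) ↔ ∃ G' ∈ G.markovClass, G'.Edge a b
      rw [this]

theorem IsUndirected.not_dir {U : MGraph V} (hU : U.IsUndirected) {a b : V} : ¬ U.Dir a b :=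
  fun h => h.2 (hU _ _ h.1).2

theorem IsUndirected.edge_of_adj {U : MGraph V} (hU : U.IsUndirected) {a b : V}
    (h : U.skeleton.Adj a b) : U.Edge a b := h.elim id fun h => (hU _ _ h).2

/-- The extensions of an undirected graph are the acyclic orientations without unshielded
colliders. -/
theorem IsUndirected.mem_extensions_iff {U : MGraph V} (hU : U.IsUndirected) {G : MGraph V} :
    G ∈ U.extensions ↔ G.IsDAG ∧ G.verts = U.verts ∧ G.skeleton = U.skeleton ∧
      ∀ a c b, ¬ G.VStruct a c b := by
  constructor
  · rintro ⟨h1, h2, h3, -, h5⟩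
    exact ⟨h1, h2, h3, fun a c b h => hU.not_dir (h5 a c b h).1⟩
  · rintro ⟨h1, h2, h3, h4⟩
    exact ⟨h1, h2, h3, fun a b h => hU.edge_of_adj (h3 ▸ .inl h), fun a c b h => absurd h (h4 a c b)⟩

/-- The extensions of an undirected graph share its skeleton and have no unshielded colliders, so
they form one Markov class, whose union is `U`. -/
theorem IsExtendable.isEssential {U : MGraph V} (hU : U.IsExtendable) (hu : U.IsUndirected) :
    U.IsEssential := by
  obtain ⟨D, hD⟩ := hU.nonempty
  have hD' := hu.mem_extensions_iff.1 hD
  have : D.markovClass = U.extensions := by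
    ext G
    rw [hD'.1.mem_markovClass_iff, hu.mem_extensions_iff, hD'.2.1, hD'.2.2.1]
    simp [hD'.2.2.2]
  refine ⟨D, hD'.1, ?_⟩
  ext a b
  · exact Finset.ext_iff.1 hD'.2.1 a
  · rw [hU.edge_iff, ← this]
    rfl

/-! ### Chain components -/

theorem mem_component {K : MGraph V} {v a : V} :
    a ∈ (K.component v).verts ↔ a ∈ K.verts ∧ K.undirPart.Reachable v a := by
  classical
  exact Finset.mem_filter

theorem component_eq_of_reachable {K : MGraph V} {v w : V} (h : K.undirPart.Reachable v w) :
    K.component v = K.component w := by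
  have key : ∀ a, K.undirPart.Reachable v a ↔ K.undirPart.Reachable w a :=
    fun a => ⟨h.symm.trans, h.trans⟩
  ext a b
  · rw [mem_component, mem_component, key]
  · change _ ∧ _ ↔ _ ∧ _
    rw [key]

theorem mem_chainComponents {K U : MGraph V} :
    U ∈ K.chainComponents ↔ ∃ v w, K.Undir v w ∧ K.component v = U := by
  classical
  constructor
  · intro h
    obtain ⟨v, hv, rfl⟩ := Finset.mem_image.1 h
    obtain ⟨-, w, hvw⟩ := Finset.mem_filter.1 hv
    exact ⟨v, w, hvw, rfl⟩
  · rintro ⟨v, w, h, rfl⟩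
    exact Finset.mem_image_of_mem _ (Finset.mem_filter.2 ⟨K.left_mem _ _ h.1, w, h⟩)

theorem chainComponents_eq_empty_iff {K : MGraph V} : K.chainComponents = ∅ ↔ K.IsDirected := by
  rw [Finset.eq_empty_iff_forall_notMem]
  constructor
  · exact fun h a b hab => ⟨hab, fun hba => h _ (mem_chainComponents.2 ⟨a, b, ⟨hab, hba⟩, rfl⟩)⟩
  · rintro h U hU
    obtain ⟨v, w, hvw, -⟩ := mem_chainComponents.1 hU
    exact (h _ _ hvw.1).2 hvw.2


theorem component_eq_of_mem {L U : MGraph V} (hU : U ∈ L.chainComponents) {a : V}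
    (ha : a ∈ U.verts) : L.component a = U := by
  obtain ⟨v, w, -, rfl⟩ := mem_chainComponents.1 hU
  exact (component_eq_of_reachable (mem_component.1 ha).2).symm

theorem edge_component {L : MGraph V} {v a b : V} :
    (L.component v).Edge a b ↔ L.Undir a b ∧ a ∈ (L.component v).verts := by
  rw [mem_component]
  change L.Undir a b ∧ L.undirPart.Reachable v a ↔ _
  exact and_congr_right fun h => ⟨fun h' => ⟨L.left_mem _ _ h.1, h'⟩, And.right⟩

theorem edge_of_mem_chainComponents {L U : MGraph V} (hU : U ∈ L.chainComponents) {a b : V} :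
    U.Edge a b ↔ L.Undir a b ∧ a ∈ U.verts := by
  obtain ⟨v, w, -, rfl⟩ := mem_chainComponents.1 hU
  exact edge_component

theorem undir_mem_verts {L U : MGraph V} (hU : U ∈ L.chainComponents) {a b : V}
    (ha : a ∈ U.verts) (h : L.Undir a b) : b ∈ U.verts :=
  U.right_mem _ _ ((edge_of_mem_chainComponents hU).2 ⟨h, ha⟩)

theorem isUndirected_of_mem_chainComponents {L U : MGraph V} (hU : U ∈ L.chainComponents) :
    U.IsUndirected := fun a b h => by
  have h' := (edge_of_mem_chainComponents hU).1 h
  exact ⟨h, (edge_of_mem_chainComponents hU).2 ⟨h'.1.symm, U.right_mem _ _ h⟩⟩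

theorem nonempty_of_mem_chainComponents {L U : MGraph V} (hU : U ∈ L.chainComponents) :
    U.verts.Nonempty := by
  obtain ⟨v, w, h, rfl⟩ := mem_chainComponents.1 hU
  exact ⟨v, mem_component.2 ⟨L.left_mem _ _ h.1, .rfl⟩⟩

theorem exists_undir_of_mem_chainComponents {L U : MGraph V} (hU : U ∈ L.chainComponents) {x : V}
    (hx : x ∈ U.verts) : ∃ y, L.Undir x y := by
  obtain ⟨v, w, h, rfl⟩ := mem_chainComponents.1 hU
  obtain ⟨p⟩ := (mem_component.1 hx).2.symm
  cases p with
  | nil => exact ⟨w, h⟩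
  | cons h _ => exact ⟨_, h⟩

theorem reachable_of_mem_chainComponents {L U : MGraph V} (hU : U ∈ L.chainComponents) {a b : V}
    (ha : a ∈ U.verts) (hb : b ∈ U.verts) : U.undirPart.Reachable a b := by
  have hab : L.undirPart.Reachable a b := by
    rw [← component_eq_of_mem hU ha] at hb
    exact (mem_component.1 hb).2
  obtain ⟨p⟩ := hab
  induction p with
  | nil => exact .rfl
  | @cons a c b h q ih =>
    have hc := undir_mem_verts hU ha h
    have hac : U.undirPart.Adj a c :=
      ⟨(edge_of_mem_chainComponents hU).2 ⟨h, ha⟩,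
        (edge_of_mem_chainComponents hU).2 ⟨Undir.symm h, hc⟩⟩
    exact hac.reachable.trans (ih hc hb)

/-- The edges of `G` that are edges of `U`. -/
def restrict (G U : MGraph V) : MGraph V where
  verts := U.verts
  Edge a b := G.Edge a b ∧ U.Edge a b
  irrefl a h := G.irrefl a h.1
  left_mem a b h := U.left_mem a b h.2
  right_mem a b h := U.right_mem a b h.2

theorem IsExtendable.restrict_mem_extensions {L U : MGraph V} (hL : L.IsExtendable)
    (hU : U ∈ L.chainComponents) {G : MGraph V} (hG : G ∈ L.extensions) :
    G.restrict U ∈ U.extensions := by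
  have hu := isUndirected_of_mem_chainComponents hU
  have hs : (G.restrict U).skeleton = U.skeleton := by
    ext a b
    refine ⟨fun h => h.imp And.right And.right, fun h => ?_⟩
    have hab := hu.edge_of_adj h
    have := ((edge_of_mem_chainComponents hU).1 hab).1.adj
    rw [← hG.2.2.1] at this
    exact this.imp (fun h => ⟨h, hab⟩) fun h => ⟨h, (hu _ _ hab).2⟩
  refine hu.mem_extensions_iff.2 ⟨isDAG_of_rank G.depth fun a b h =>
    depth_lt hG.1.2 (hG.1.1 _ _ h.1), rfl, hs, fun a c b h => ?_⟩
  obtain ⟨⟨⟨h1, h2⟩, -⟩, ⟨⟨h3, h4⟩, -⟩, hne, hn⟩ := h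
  have h5 := (edge_of_mem_chainComponents hU).1 h2
  have h6 := (edge_of_mem_chainComponents hU).1 h4
  have h7 := hL.undir_of_dir hG h5.1 h6.1 (hG.1.1 _ _ h1) (hG.1.1 _ _ h3) hne
  rw [hs] at hn
  exact hn (.inl ((edge_of_mem_chainComponents hU).2 ⟨h7, h5.2⟩))

theorem IsExtendable.chainComponent {L U : MGraph V} (hL : L.IsExtendable)
    (hU : U ∈ L.chainComponents) : U.IsExtendable := by
  obtain ⟨G, hG⟩ := hL.nonempty
  exact ⟨fun a b c h => absurd h (isUndirected_of_mem_chainComponents hU).not_dir,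
    G.restrict U, hL.restrict_mem_extensions hU hG⟩

theorem IsExtendable.isUCEG {L U : MGraph V} (hL : L.IsExtendable)
    (hU : U ∈ L.chainComponents) : U.IsUCEG :=
  ⟨(hL.chainComponent hU).isEssential (isUndirected_of_mem_chainComponents hU),
    isUndirected_of_mem_chainComponents hU, nonempty_of_mem_chainComponents hU,
    fun _ ha _ hb => reachable_of_mem_chainComponents hU ha hb⟩

/-! ### Rooted subclasses -/

namespace IsUCEG

variable {U : MGraph V}

/-- Every acyclic orientation without unshielded colliders of a connected graph has exactly one
root. -/
theorem existsUnique_root (hU : U.IsUCEG) {G : MGraph V} (hG : G ∈ U.extensions) :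
    ∃! x, x ∈ U.verts ∧ G.IsRoot x := by
  obtain ⟨-, hu, hne, hconn⟩ := hU
  obtain ⟨hd, hv, hs, hV⟩ := hu.mem_extensions_iff.1 hG
  obtain ⟨x, hx, hmin⟩ := Finset.exists_min_image U.verts G.depth hne
  have hroot : G.IsRoot x := ⟨hv ▸ hx, fun a h =>
    absurd (hmin a (hv ▸ G.left_mem _ _ h.1)) (depth_lt hd.2 h).not_ge⟩
  -- The descendants of `x` are closed under parents: two parents of `v` are adjacent, so `w` lies
  -- below the predecessor `z` of `v` or is a parent of `z`, and the path to `x` gets shorter. By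
  -- connectedness every vertex is then a descendant of `x`.
  have up : ∀ v w, G.Desc x v → G.Dir w v → G.Desc x w := by
    intro v w h
    induction h generalizing w with
    | refl => exact fun h => absurd h (hroot.2 w)
    | @tail z v hz hzv ih =>
      intro hwv
      by_cases hzw : z = w
      · exact hzw ▸ hz
      · have hadj : G.skeleton.Adj z w := by
          by_contra hn
          exact hV z v w ⟨hzv, hwv, hzw, hn⟩
        rcases hd.adj_iff.1 hadj with h | h
        · exact hz.tail h
        · exact ih w h
  have hdesc : ∀ v w (_ : U.undirPart.Walk v w), G.Desc x v → G.Desc x w := by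
    intro v w p
    induction p with
    | nil => exact id
    | @cons v z w h _ ih =>
      intro hxv
      refine ih ?_
      rcases hd.adj_iff.1 (hs ▸ Undir.adj h : G.skeleton.Adj v z) with h' | h'
      · exact hxv.tail h'
      · exact up v z hxv h'
  refine ⟨x, ⟨hx, hroot⟩, fun y ⟨hy, hy'⟩ => ?_⟩
  obtain ⟨p⟩ := hconn x hx y hy
  rcases (hdesc x y p .refl).cases_tail with h | ⟨z, -, h⟩
  · exact h
  · exact absurd h (hy'.2 z)

theorem isExtendable (hU : U.IsUCEG) : U.IsExtendable := hU.1.isExtendable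

theorem mem_rootedClass_iff (hU : U.IsUCEG) {x : V} {G : MGraph V} :
    G ∈ U.rootedClass x ↔ G ∈ U.extensions ∧ G.IsRoot x := by
  change G ∈ U.mec ∧ _ ↔ _
  rw [hU.1.mec_eq]

/-- Being a root prescribes all arrows out of `x`. They have the same tail, so allowing colliders
made of them allows none. -/
theorem rootedClass_eq_orientations (hU : U.IsUCEG) {x : V} (hx : x ∈ U.verts) :
    U.rootedClass x = orientations U.verts U.skeleton fun a b => a = x ∧ U.Edge a b := by
  ext G
  rw [hU.mem_rootedClass_iff, hU.2.1.mem_extensions_iff]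
  constructor
  · rintro ⟨⟨hd, hv, hs, hV⟩, hr⟩
    refine ⟨hd, hv, hs, ?_, fun a c b h => absurd h (hV a c b)⟩
    rintro a b ⟨rfl, h⟩
    exact (hd.adj_iff.1 (hs ▸ .inl h : G.skeleton.Adj a b)).resolve_right (hr.2 b)
  · rintro ⟨hd, hv, hs, hB, hV⟩
    refine ⟨⟨hd, hv, hs, fun a c b h => ?_⟩, hv ▸ hx, fun a h => ?_⟩
    · exact h.2.2.1 ((hV a c b h).1.trans (hV b c a h.symm).1.symm)
    · exact h.not_dir (hB x a ⟨rfl, hU.2.1.edge_of_adj (hs ▸ h.adj.symm)⟩)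

theorem rooted_spec (hU : U.IsUCEG) {x : V} (hx : x ∈ U.verts) :
    (U.rooted x).IsExtendable ∧ (U.rooted x).extensions = U.rootedClass x := by
  have h := hU.rootedClass_eq_orientations hx
  rw [h]
  refine isExtendable_of_union ?_ ?_ rfl fun a b => by rw [← h]; rfl
  · rintro a b ⟨rfl, -⟩
    exact .inr fun c hc => ⟨rfl, hU.2.1.edge_of_adj hc⟩
  · obtain ⟨D, hD, hD'⟩ := hU.isExtendable.exists_extension_rooted x
    rw [← h]
    refine ⟨D, hU.mem_rootedClass_iff.2 ⟨hD, hD.2.1 ▸ hx, fun a ha => ?_⟩⟩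
    have hxa : U.Edge x a := hU.2.1.edge_of_adj (hD.2.2.1 ▸ ha.adj.symm)
    exact ha.not_dir (hD' a (hU.2.1 _ _ hxa))

theorem edge_of_rooted (hU : U.IsUCEG) {x a b : V} (h : (U.rooted x).Edge a b) : U.Edge a b := by
  obtain ⟨G, hG, h⟩ := h
  exact (hU.mem_rootedClass_iff.1 hG).1.2.2.2.1 _ _ h

theorem skeleton_rooted (hU : U.IsUCEG) {x : V} (hx : x ∈ U.verts) :
    (U.rooted x).skeleton = U.skeleton := by
  obtain ⟨h1, h2⟩ := hU.rooted_spec hx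
  obtain ⟨G, hG⟩ := h1.nonempty
  rw [← hG.2.2.1]
  rw [h2] at hG
  exact (hU.mem_rootedClass_iff.1 hG).1.2.2.1

theorem dir_rooted (hU : U.IsUCEG) {x : V} {b : V} (h : U.Edge x b) : (U.rooted x).Dir x b := by
  have hadj : (U.rooted x).skeleton.Adj x b :=
    hU.skeleton_rooted (U.left_mem _ _ h) ▸ .inl h
  have hn : ¬ (U.rooted x).Edge b x := by
    rintro ⟨G, hG, h⟩
    have hG' := hU.mem_rootedClass_iff.1 hG
    exact hG'.2.2 b (hG'.1.1.1 _ _ h)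
  exact ⟨hadj.resolve_right hn, hn⟩

end IsUCEG

/-! ### Orienting a chain component from a root -/

section Orient

variable {L U : MGraph V} {x : V}

theorem undir_orient {R : MGraph V} {a b : V} :
    (L.orient R).Undir a b ↔ L.Undir a b ∧ ¬ R.Dir a b ∧ ¬ R.Dir b a := by
  change (L.Edge a b ∧ _) ∧ (L.Edge b a ∧ _) ↔ (L.Edge a b ∧ L.Edge b a) ∧ _
  tauto

theorem dir_orient {R : MGraph V} (hR : ∀ a b, R.Dir a b → L.Undir a b) {a b : V} :
    (L.orient R).Dir a b ↔ L.Dir a b ∨ R.Dir a b := by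
  change (L.Edge a b ∧ ¬ R.Dir b a) ∧ ¬ (L.Edge b a ∧ ¬ R.Dir a b) ↔
    (L.Edge a b ∧ ¬ L.Edge b a) ∨ _
  have h1 := hR a b
  have h2 := hR b a
  have h3 := @Dir.not_dir _ R a b
  unfold Undir at h1 h2
  tauto

theorem skeleton_orient {R : MGraph V} (hR : ∀ a b, R.Dir a b → L.Undir a b) :
    (L.orient R).skeleton = L.skeleton := by
  ext a b
  rw [skeleton_adj_iff, skeleton_adj_iff, dir_orient hR, dir_orient hR, undir_orient]
  have h1 := hR a b
  have h2 := hR b a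
  have h3 := @Undir.symm _ L a b
  have h4 := @Undir.symm _ L b a
  tauto

theorem IsExtendable.undir_of_dir_rooted (hL : L.IsExtendable) (hU : U ∈ L.chainComponents)
    {a b : V} (h : (U.rooted x).Dir a b) : L.Undir a b :=
  ((edge_of_mem_chainComponents hU).1 ((hL.isUCEG hU).edge_of_rooted h.1)).1

/-- An extension of `L` restricts to a member of the class of `U`; if that has root `x`, it respects
all arrows of `U.rooted x`. Conversely these arrows bring no new unshielded collider, alone or
together with an arrow of `L`. -/
theorem IsExtendable.mem_extensions_orient_iff (hL : L.IsExtendable)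
    (hU : U ∈ L.chainComponents) (hx : x ∈ U.verts) {G : MGraph V} :
    G ∈ (L.orient (U.rooted x)).extensions ↔ G ∈ L.extensions ∧ (G.restrict U).IsRoot x := by
  have hUC := hL.isUCEG hU
  have hR : ∀ a b, (U.rooted x).Dir a b → L.Undir a b := fun a b => hL.undir_of_dir_rooted hU
  obtain ⟨hRe, hRext⟩ := hUC.rooted_spec hx
  constructor
  · rintro ⟨h1, h2, h3, h4, h5⟩
    rw [skeleton_orient hR] at h3
    refine ⟨⟨h1, h2, h3, fun a b h => (h4 a b h).1, fun a c b h => ?_⟩, hx, fun a ha => ?_⟩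
    · obtain ⟨hac, hbc⟩ := h5 a c b h
      have hn : ¬ L.skeleton.Adj a b := h3 ▸ h.2.2.2
      rcases (dir_orient hR).1 hac with hac | hac <;> rcases (dir_orient hR).1 hbc with hbc | hbc
      · exact ⟨hac, hbc⟩
      · exact absurd (hL.dir_of_undir _ _ _ hac (hR _ _ hbc).symm).adj hn
      · exact absurd (hL.dir_of_undir _ _ _ hbc (hR _ _ hac).symm).adj.symm hn
      -- Both arrows come from `U.rooted x`, so any member of the rooted class would contain the
      -- unshielded collider.
      · exfalso
        obtain ⟨H, hH⟩ := hRe.nonempty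
        have hH' := hUC.mem_rootedClass_iff.1 (hRext ▸ hH)
        have hHU := hUC.2.1.mem_extensions_iff.1 hH'.1
        refine hHU.2.2.2 a c b ⟨dir_of_mem_extensions hH hac, dir_of_mem_extensions hH hbc,
          h.2.2.1, fun h' => hn ?_⟩
        rw [hHU.2.2.1] at h'
        exact ((edge_of_mem_chainComponents hU).1 (hUC.2.1.edge_of_adj h')).1.adj
    · have hxa := hUC.dir_rooted (hUC.2.1 _ _ ha.1.2).2
      exact (h4 a x ha.1.1).2 hxa
  · rintro ⟨hG, hroot⟩
    have hres : G.restrict U ∈ U.rootedClass x :=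
      hUC.mem_rootedClass_iff.2 ⟨hL.restrict_mem_extensions hU hG, hroot⟩
    refine ⟨hG.1, hG.2.1, hG.2.2.1.trans (skeleton_orient hR).symm,
      fun a b h => ⟨hG.2.2.2.1 a b h, fun h' => h'.2 ?_⟩, fun a c b h => ?_⟩
    · exact ⟨_, hres, h, (hUC.2.1 _ _ (hUC.edge_of_rooted h'.1)).2⟩
    · obtain ⟨h1, h2⟩ := hG.2.2.2.2 a c b h
      exact ⟨(dir_orient hR).2 (.inl h1), (dir_orient hR).2 (.inl h2)⟩

theorem undir_rooted_iff (hL : L.IsExtendable) (hU : U ∈ L.chainComponents) (hx : x ∈ U.verts)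
    {a b : V} (ha : a ∈ U.verts) :
    (U.rooted x).Undir a b ↔ (L.orient (U.rooted x)).Undir a b := by
  have hUC := hL.isUCEG hU
  rw [undir_orient]
  constructor
  · intro h
    exact ⟨((edge_of_mem_chainComponents hU).1 (hUC.edge_of_rooted h.1)).1,
      fun h' => h'.not_undir h, fun h' => h'.not_undir h.symm⟩
  · rintro ⟨h1, h2, h3⟩
    have hadj : (U.rooted x).skeleton.Adj a b := by
      rw [hUC.skeleton_rooted hx]
      exact .inl ((edge_of_mem_chainComponents hU).2 ⟨h1, ha⟩)
    have := skeleton_adj_iff.1 hadj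
    tauto

theorem IsExtendable.orient (hL : L.IsExtendable) (hU : U ∈ L.chainComponents)
    (hx : x ∈ U.verts) : (L.orient (U.rooted x)).IsExtendable := by
  have hUC := hL.isUCEG hU
  have hR : ∀ a b, (U.rooted x).Dir a b → L.Undir a b := fun a b => hL.undir_of_dir_rooted hU
  refine ⟨fun a b c hab hbc => ?_, ?_⟩
  · rw [dir_orient hR] at hab ⊢
    rcases hab with hab | hab
    · exact .inl (hL.dir_of_undir _ _ _ hab (undir_orient.1 hbc).1)
    · refine .inr ((hUC.rooted_spec hx).1.dir_of_undir _ _ _ hab ?_)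
      exact (undir_rooted_iff hL hU hx ((U.rooted x).right_mem _ _ hab.1)).2 hbc
  · obtain ⟨D, hD, hD'⟩ := hL.exists_extension_rooted x
    refine ⟨D, (hL.mem_extensions_orient_iff hU hx).2 ⟨hD, hx, fun a ha => ?_⟩⟩
    have := ((edge_of_mem_chainComponents hU).1 ha.1.2).1
    exact (hD' a this.symm).2 ha.1.1

theorem component_eq_of_agree {K K' : MGraph V} {W : Set V}
    (hv : ∀ a ∈ W, a ∈ K.verts ↔ a ∈ K'.verts)
    (hu : ∀ a ∈ W, ∀ b, K.Undir a b ↔ K'.Undir a b)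
    (hW : ∀ a ∈ W, ∀ b, K.Undir a b → b ∈ W) {v : V} (hvW : v ∈ W) :
    K.component v = K'.component v := by
  have key : ∀ {K K' : MGraph V}, (∀ a ∈ W, ∀ b, K.Undir a b ↔ K'.Undir a b) →
      (∀ a ∈ W, ∀ b, K.Undir a b → b ∈ W) → ∀ {v w}, v ∈ W → K.undirPart.Reachable v w →
      w ∈ W ∧ K'.undirPart.Reachable v w := by
    rintro K K' hu hW v w hvW ⟨p⟩
    induction p with
    | nil => exact ⟨hvW, .rfl⟩
    | @cons a c b h q ih =>
      obtain ⟨h1, h2⟩ := ih (hW a hvW c h)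
      have : K'.undirPart.Adj a c := (hu a hvW c).1 h
      exact ⟨h1, this.reachable.trans h2⟩
  have hW' : ∀ a ∈ W, ∀ b, K'.Undir a b → b ∈ W := fun a ha b h => hW a ha b ((hu a ha b).2 h)
  have hr : ∀ w, K.undirPart.Reachable v w ↔ K'.undirPart.Reachable v w := fun w =>
    ⟨fun h => (key hu hW hvW h).2, fun h => (key (fun a ha b => (hu a ha b).symm) hW' hvW h).2⟩
  have hmem : ∀ a, a ∈ (K.component v).verts ↔ a ∈ (K'.component v).verts := by
    intro a
    rw [mem_component, mem_component, hr]
    exact and_congr_left fun h => hv a (key hu hW hvW ((hr a).2 h)).1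
  ext a b
  · exact hmem a
  · rw [edge_component, edge_component, hmem]
    refine and_congr_left fun h => hu a ?_ b
    exact (key hu hW hvW ((hr a).2 (mem_component.1 h).2)).1

-- The sampler's update of its work set: `U.verts` and its complement are both closed under
-- undirected edges, and on each the components can be computed separately.
open Classical in
theorem IsExtendable.chainComponents_orient (hL : L.IsExtendable) (hU : U ∈ L.chainComponents)
    (hx : x ∈ U.verts) :
    (L.orient (U.rooted x)).chainComponents =
      (L.chainComponents \ {U}) ∪ (U.rooted x).chainComponents := by
  have hR : ∀ a b, (U.rooted x).Dir a b → L.Undir a b := fun a b => hL.undir_of_dir_rooted hU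
  have hUV : ∀ a ∈ U.verts, a ∈ L.verts := fun a ha => by
    obtain ⟨y, hy⟩ := exists_undir_of_mem_chainComponents hU ha
    exact L.left_mem _ _ hy.1
  have inside : ∀ v ∈ U.verts,
      (U.rooted x).component v = (L.orient (U.rooted x)).component v := fun v hv =>
    component_eq_of_agree (K := U.rooted x) (K' := L.orient (U.rooted x))
      (W := (U.verts : Set V))
      (fun a ha => ⟨fun _ => hUV a ha, fun _ => ha⟩)
      (fun a ha b => undir_rooted_iff hL hU hx ha)
      (fun a _ b h => (U.rooted x).right_mem _ _ h.1) hv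
  have houtside : ∀ a, a ∉ U.verts → ∀ b, L.Undir a b ↔ (L.orient (U.rooted x)).Undir a b := by
    intro a ha b
    rw [undir_orient]
    exact ⟨fun h => ⟨h, fun h' => ha ((U.rooted x).left_mem _ _ h'.1),
      fun h' => ha ((U.rooted x).right_mem _ _ h'.1)⟩, And.left⟩
  have outside : ∀ v, v ∉ U.verts →
      L.component v = (L.orient (U.rooted x)).component v := fun v hv =>
    component_eq_of_agree (K := L) (K' := L.orient (U.rooted x)) (W := {v | v ∉ U.verts})
      (fun _ _ => Iff.rfl) houtside
      (fun a ha b h hb => ha (undir_mem_verts hU hb h.symm)) hv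
  ext T
  simp only [Finset.mem_union, Finset.mem_sdiff, Finset.mem_singleton, mem_chainComponents]
  constructor
  · rintro ⟨v, w, hvw, rfl⟩
    by_cases hv : v ∈ U.verts
    · exact .inr ⟨v, w, (undir_rooted_iff hL hU hx hv).2 hvw, inside v hv⟩
    · refine .inl ⟨⟨v, w, (houtside v hv w).2 hvw, outside v hv⟩, fun h => hv ?_⟩
      rw [← h]
      exact mem_component.2 ⟨L.left_mem _ _ (undir_orient.1 hvw).1.1, .rfl⟩
  · rintro (⟨⟨v, w, hvw, rfl⟩, hne⟩ | ⟨v, w, hvw, rfl⟩)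
    · have hv : v ∉ U.verts := fun hv => hne (component_eq_of_mem hU hv)
      exact ⟨v, w, (houtside v hv w).1 hvw, (outside v hv).symm⟩
    · have hv : v ∈ U.verts := (U.rooted x).left_mem _ _ hvw.1
      exact ⟨v, w, (undir_rooted_iff hL hU hx hv).1 hvw, (inside v hv).symm⟩

open Classical in
theorem disjoint_chainComponents_rooted (hU : U ∈ L.chainComponents) :
    Disjoint (L.chainComponents \ {U}) (U.rooted x).chainComponents := by
  refine Finset.disjoint_left.2 fun T hT hT' => ?_
  obtain ⟨hT, hne⟩ := Finset.mem_sdiff.1 hT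
  obtain ⟨v, w, hvw, rfl⟩ := mem_chainComponents.1 hT'
  have hv := (U.rooted x).left_mem _ _ hvw.1
  have hv' : v ∈ ((U.rooted x).component v).verts := mem_component.2 ⟨hv, .rfl⟩
  refine hne (Finset.mem_singleton.2 ?_)
  rw [← component_eq_of_mem hT hv']
  exact component_eq_of_mem hU hv

theorem undirCount_orient_lt (hL : L.IsExtendable) (hU : U ∈ L.chainComponents)
    (hx : x ∈ U.verts) : (L.orient (U.rooted x)).undirCount < L.undirCount := by
  classical
  obtain ⟨y, hxy⟩ := exists_undir_of_mem_chainComponents hU hx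
  refine Finset.card_lt_card (Finset.ssubset_iff_subset_ne.2 ⟨fun p hp => ?_, fun he => ?_⟩)
  · obtain ⟨h1, h2⟩ := Finset.mem_filter.1 hp
    exact Finset.mem_filter.2 ⟨h1, (undir_orient.1 h2).1⟩
  · have : (x, y) ∈ ({p ∈ L.verts ×ˢ L.verts | L.Undir p.1 p.2} : Finset (V × V)) :=
      Finset.mem_filter.2
        ⟨Finset.mem_product.2 ⟨L.left_mem _ _ hxy.1, L.right_mem _ _ hxy.1⟩, hxy⟩
    rw [← he] at this
    refine (undir_orient.1 (Finset.mem_filter.1 this).2).2.1 ?_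
    exact (hL.isUCEG hU).dir_rooted ((edge_of_mem_chainComponents hU).2 ⟨hxy, hx⟩)

end Orient

/-! ### Counting extensions -/

theorem finite_extensions (L : MGraph V) : L.extensions.Finite := by
  classical
  refine Set.Finite.of_finite_image (f := fun G : MGraph V =>
    {p ∈ L.verts ×ˢ L.verts | G.Dir p.1 p.2}) ?_ ?_
  · refine (L.verts ×ˢ L.verts).powerset.finite_toSet.subset ?_
    rintro _ ⟨G, -, rfl⟩
    exact Finset.mem_coe.2 (Finset.mem_powerset.2 (Finset.filter_subset _ _))
  · intro G hG H hH h
    refine hG.1.ext_dir hH.1 (hG.2.1.trans hH.2.1.symm) fun a b => ?_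
    have key : ∀ K ∈ L.extensions, K.Dir a b ↔
        (a, b) ∈ {p ∈ L.verts ×ˢ L.verts | K.Dir p.1 p.2} := fun K hK => by
      rw [Finset.mem_filter, Finset.mem_product]
      exact ⟨fun h => ⟨⟨hK.2.1 ▸ K.left_mem _ _ h.1, hK.2.1 ▸ K.right_mem _ _ h.1⟩, h⟩, And.right⟩
    rw [key G hG, key H hH]
    exact Finset.ext_iff.1 h (a, b)

theorem ncard_eq_sum_of_existsUnique {α β : Type*} {s : Set α} (hs : s.Finite) (W : Finset β)
    (p : α → β → Prop) (h : ∀ g ∈ s, ∃! x, x ∈ W ∧ p g x) :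
    s.ncard = ∑ x ∈ W, {g ∈ s | p g x}.ncard := by
  classical
  have hU : s = ⋃ x ∈ W, {g ∈ s | p g x} := by
    ext g
    simp only [Set.mem_iUnion, exists_prop]
    constructor
    · intro hg
      obtain ⟨x, hx, -⟩ := h g hg
      exact ⟨x, hx.1, hg, hx.2⟩
    · rintro ⟨x, -, hg, -⟩
      exact hg
  have hfin : ∀ x, ({g ∈ s | p g x}).Finite := fun x => hs.subset fun g hg => hg.1
  have hF : hs.toFinset = W.biUnion fun x => (hfin x).toFinset := by
    ext g
    rw [Set.Finite.mem_toFinset, Finset.mem_biUnion]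
    conv_lhs => rw [hU]
    simp only [Set.mem_iUnion, exists_prop, Set.Finite.mem_toFinset]
  rw [Set.ncard_eq_toFinset_card s hs, hF, Finset.card_biUnion]
  · exact Finset.sum_congr rfl fun x _ => (Set.ncard_eq_toFinset_card _ _).symm
  · intro x hx y hy hxy
    rw [Function.onFun, Finset.disjoint_left]
    intro g hg hg'
    rw [Set.Finite.mem_toFinset] at hg hg'
    exact hxy ((h g hg.1).unique ⟨hx, hg.2⟩ ⟨hy, hg'.2⟩)

theorem IsUCEG.size_eq_sum {U : MGraph V} (hU : U.IsUCEG) :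
    U.size = ∑ x ∈ U.verts, U.rootedSize x := by
  unfold size rootedSize rootedClass
  rw [hU.1.mec_eq]
  exact ncard_eq_sum_of_existsUnique U.finite_extensions _ _ fun G hG => hU.existsUnique_root hG

theorem IsExtendable.ncard_eq_sum {L U : MGraph V} (hL : L.IsExtendable)
    (hU : U ∈ L.chainComponents) :
    L.extensions.ncard = ∑ x ∈ U.verts, (L.orient (U.rooted x)).extensions.ncard := by
  rw [ncard_eq_sum_of_existsUnique L.finite_extensions U.verts
    (fun G x => (G.restrict U).IsRoot x) fun G hG =>
      (hL.isUCEG hU).existsUnique_root (hL.restrict_mem_extensions hU hG)]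
  refine Finset.sum_congr rfl fun x hx => congrArg _ ?_
  ext G
  exact (hL.mem_extensions_orient_iff hU hx).symm

theorem IsExtendable.extensions_eq_of_isDirected {L : MGraph V} (hL : L.IsExtendable)
    (h : L.IsDirected) : L.extensions = {L} := by
  have key : ∀ G ∈ L.extensions, G = L := fun G hG => by
    ext a b
    · rw [hG.2.1]
    · exact ⟨hG.2.2.2.1 a b, fun h' => (dir_of_mem_extensions hG (h _ _ h')).1⟩
  obtain ⟨G, hG⟩ := hL.nonempty
  exact Set.eq_singleton_iff_unique_mem.2 ⟨key G hG ▸ hG, key⟩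

theorem IsUCEG.rootedSize_eq {U : MGraph V} (hU : U.IsUCEG) {x : V} (hx : x ∈ U.verts) :
    U.rootedSize x = (U.rooted x).extensions.ncard := by
  rw [(hU.rooted_spec hx).2, rootedSize]

/-- Induction on undirected edges: splitting by the root of `U`, each part has the sizes of the
other components as a common factor, and the remaining factors sum to `U.size`. -/
theorem IsExtendable.ncard_eq_prod {L : MGraph V} (hL : L.IsExtendable) :
    L.extensions.ncard = ∏ U ∈ L.chainComponents, U.size := by
  classical
  obtain ⟨n, hn⟩ : ∃ n, L.undirCount = n := ⟨_, rfl⟩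
  induction n using Nat.strong_induction_on generalizing L with
  | _ n ih =>
    subst hn
    rcases L.chainComponents.eq_empty_or_nonempty with h | ⟨U, hU⟩
    · rw [h, hL.extensions_eq_of_isDirected (chainComponents_eq_empty_iff.1 h)]
      simp
    · have hUC := hL.isUCEG hU
      have step : ∀ x ∈ U.verts, (L.orient (U.rooted x)).extensions.ncard =
          (∏ T ∈ L.chainComponents \ {U}, T.size) * U.rootedSize x := fun x hx => by
        rw [ih _ (undirCount_orient_lt hL hU hx) (hL.orient hU hx) rfl,
          hL.chainComponents_orient hU hx,
          Finset.prod_union (disjoint_chainComponents_rooted hU), hUC.rootedSize_eq hx,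
          ih _ (undirCount_rooted_lt hU hx) (hUC.rooted_spec hx).1 rfl]
      rw [hL.ncard_eq_sum hU, Finset.sum_congr rfl step, ← Finset.mul_sum, ← hUC.size_eq_sum,
        Finset.sdiff_singleton_eq_erase, Finset.prod_erase_mul _ _ hU]

/-- The counting procedure is correct. -/
theorem IsExtendable.counter_eq {K H : MGraph V} (hK : K.IsExtendable)
    (hH : ∀ a b, K.Edge a b → H.Edge a b) : counter K H = K.extensions.ncard := by
  classical
  obtain ⟨n, hn⟩ : ∃ n, K.undirCount = n := ⟨_, rfl⟩
  induction n using Nat.strong_induction_on generalizing K with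
  | _ n ih =>
    subst hn
    rw [counter]
    split_ifs with hd
    · rw [hK.extensions_eq_of_isDirected hd, Set.ncard_singleton]
    · rw [hK.ncard_eq_prod, ← Finset.prod_attach K.chainComponents fun U => U.size]
      refine Finset.prod_congr rfl fun U _ => ?_
      have hUC := hK.isUCEG U.2
      rw [hUC.size_eq_sum, ← Finset.sum_attach U.1.verts U.1.rootedSize]
      refine Finset.sum_congr rfl fun x _ => ?_
      -- Rooted graphs lie inside their component, so the test against `H` never fails.
      have hsub : ∀ a b, (U.1.rooted x.1).Edge a b → H.Edge a b := fun a b h =>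
        hH a b ((edge_of_mem_chainComponents U.2).1 (hUC.edge_of_rooted h)).1.1
      rw [if_pos hsub, hUC.rootedSize_eq x.2]
      exact ih _ (undirCount_rooted_lt U.2 x.2) (hUC.rooted_spec x.2).1 hsub rfl

theorem IsUCEG.rootProb_eq {U : MGraph V} (hU : U.IsUCEG) {x : V} (hx : x ∈ U.verts) :
    U.rootProb x = (U.rootedSize x : ℝ≥0∞) / (U.size : ℝ≥0∞) := by
  rw [rootProb, if_pos hx, (hU.rooted_spec hx).1.counter_eq fun _ _ h => h,
    hU.isExtendable.counter_eq fun _ _ h => h, hU.rootedSize_eq hx, size, hU.1.mec_eq]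

theorem IsExtendable.ncard_ne_zero {L : MGraph V} (hL : L.IsExtendable) :
    L.extensions.ncard ≠ 0 :=
  (Set.ncard_pos L.finite_extensions).2 hL.nonempty |>.ne'

theorem IsUCEG.size_ne_zero {U : MGraph V} (hU : U.IsUCEG) : U.size ≠ 0 := by
  rw [size, hU.1.mec_eq]
  exact hU.isExtendable.ncard_ne_zero

theorem IsUCEG.rootedSize_ne_zero {U : MGraph V} (hU : U.IsUCEG) {x : V} (hx : x ∈ U.verts) :
    U.rootedSize x ≠ 0 := by
  rw [hU.rootedSize_eq hx]
  exact (hU.rooted_spec hx).1.ncard_ne_zero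

theorem IsUCEG.sum_rootProb {U : MGraph V} (hU : U.IsUCEG) : ∑ x ∈ U.verts, U.rootProb x = 1 := by
  rw [Finset.sum_congr rfl fun x hx => hU.rootProb_eq hx]
  simp only [div_eq_mul_inv]
  rw [← Finset.sum_mul, ← Nat.cast_sum, ← hU.size_eq_sum]
  exact ENNReal.mul_inv_cancel (Nat.cast_ne_zero.2 hU.size_ne_zero) (ENNReal.natCast_ne_top _)

/-- Stated without division: the proportion of extensions of `L` with root `x` on `U` equals the
root probability. -/
theorem IsExtendable.ncard_orient {L U : MGraph V} (hL : L.IsExtendable)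
    (hU : U ∈ L.chainComponents) {x : V} (hx : x ∈ U.verts) :
    (L.orient (U.rooted x)).extensions.ncard * U.size = L.extensions.ncard * U.rootedSize x := by
  classical
  rw [(hL.orient hU hx).ncard_eq_prod, hL.chainComponents_orient hU hx,
    Finset.prod_union (disjoint_chainComponents_rooted hU), (hL.isUCEG hU).rootedSize_eq hx,
    ((hL.isUCEG hU).rooted_spec hx).1.ncard_eq_prod, hL.ncard_eq_prod,
    Finset.sdiff_singleton_eq_erase, ← Finset.prod_erase_mul _ _ hU]
  ring

open Classical in
/-- The uniform distribution on the extensions of `L`. -/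
noncomputable def uniformExtension (L : MGraph V) : PMF (MGraph V) :=
  if h : L.extensions.Nonempty then
    PMF.uniformOfFinset L.finite_extensions.toFinset ((Set.Finite.toFinset_nonempty _).2 h)
  else PMF.pure L

open Classical in
theorem IsExtendable.uniformExtension_apply {L : MGraph V} (hL : L.IsExtendable) (G : MGraph V) :
    L.uniformExtension G = if G ∈ L.extensions then (L.extensions.ncard : ℝ≥0∞)⁻¹ else 0 := by
  rw [uniformExtension, dif_pos hL.nonempty, PMF.uniformOfFinset_apply,
    Set.ncard_eq_toFinset_card _ L.finite_extensions]
  simp only [Set.Finite.mem_toFinset]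

theorem IsExtendable.uniformExtension_eq_pure {L : MGraph V} (hL : L.IsExtendable)
    (h : L.IsDirected) : L.uniformExtension = PMF.pure L := by
  classical
  ext G
  rw [hL.uniformExtension_apply, hL.extensions_eq_of_isDirected h, PMF.pure_apply]
  simp

end MGraph

/-! ### The law of the sampler -/

theorem PMF.bind_congr_support {α β : Type*} (p : PMF α) {f g : α → PMF β}
    (h : ∀ a ∈ p.support, f a = g a) : p.bind f = p.bind g := by
  ext b
  rw [PMF.bind_apply, PMF.bind_apply]
  refine tsum_congr fun a => ?_
  by_cases ha : a ∈ p.support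
  · rw [h a ha]
  · rw [PMF.mem_support_iff, not_not] at ha
    rw [ha, zero_mul, zero_mul]

namespace SamplerState

variable {V : Type*}

open MGraph

/-- The work set of `σ` consists of the chain components of its extendable graph. -/
structure Valid (σ : SamplerState V) : Prop where
  extendable : σ.graph.IsExtendable
  work_eq : σ.work = σ.graph.chainComponents

namespace Valid

variable {σ : SamplerState V} {pick : SamplerState V → MGraph V}

theorem next (hσ : σ.Valid) {U : MGraph V} (hU : U ∈ σ.work) {x : V} (hx : x ∈ U.verts) :
    (σ.next U x).Valid := by
  have hU' := hσ.work_eq ▸ hU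
  have h := hσ.extendable.chainComponents_orient hU' hx
  rw [← hσ.work_eq] at h
  exact ⟨hσ.extendable.orient hU' hx, h.symm⟩

theorem step_eq (hσ : σ.Valid) (hpick : pick σ ∈ σ.work) :
    ∃ p : PMF V, step pick σ = p.map (σ.next (pick σ)) ∧ ∀ x, p x = (pick σ).rootProb x := by
  have hUC := hσ.extendable.isUCEG (hσ.work_eq ▸ hpick)
  rw [step, dif_pos ⟨⟨_, hpick⟩, hUC.sum_rootProb⟩]
  exact ⟨_, rfl, fun x => PMF.ofFinset_apply _ _ x⟩

theorem exists_of_mem_support_step (hσ : σ.Valid) (hpick : pick σ ∈ σ.work) {τ : SamplerState V}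
    (hτ : τ ∈ (step pick σ).support) : ∃ x ∈ (pick σ).verts, τ = σ.next (pick σ) x := by
  obtain ⟨p, hp, hpx⟩ := hσ.step_eq hpick
  rw [hp, PMF.mem_support_map_iff] at hτ
  obtain ⟨x, hx, rfl⟩ := hτ
  refine ⟨x, ?_, rfl⟩
  by_contra hn
  rw [PMF.mem_support_iff, hpx, rootProb, if_neg hn] at hx
  exact hx rfl

/-- One iteration preserves the mean of the uniform distributions on the extensions. -/
theorem step_bind (hσ : σ.Valid) (hpick : σ.work.Nonempty → pick σ ∈ σ.work) :
    ((step pick σ).bind fun τ => τ.graph.uniformExtension) = σ.graph.uniformExtension := by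
  classical
  by_cases hne : σ.work.Nonempty
  · have hpick := hpick hne
    have hU := hσ.work_eq ▸ hpick
    have hL := hσ.extendable
    have hUC := hL.isUCEG hU
    obtain ⟨p, hp, hpx⟩ := hσ.step_eq hpick
    rw [hp, PMF.bind_map]
    ext G
    rw [PMF.bind_apply, tsum_eq_sum (s := (pick σ).verts) fun x hx => by
      rw [hpx, rootProb, if_neg hx, zero_mul]]
    -- The probability of the root cancels against the smaller number of extensions left. Each
    -- extension `G` then gets its old weight from exactly one summand, that of its own root on the
    -- component.
    have key : ∀ x ∈ (pick σ).verts,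
        p x * (((fun τ : SamplerState V => τ.graph.uniformExtension) ∘ σ.next (pick σ)) x) G =
          if G ∈ σ.graph.extensions ∧ (G.restrict (pick σ)).IsRoot x then
            (σ.graph.extensions.ncard : ℝ≥0∞)⁻¹ else 0 := by
      intro x hx
      change p x * (σ.graph.orient ((pick σ).rooted x)).uniformExtension G = _
      rw [hpx, hUC.rootProb_eq hx, (hL.orient hU hx).uniformExtension_apply]
      simp only [hL.mem_extensions_orient_iff hU hx]
      split_ifs with h
      · have hn := hL.ncard_orient hU hx
        have hr : ((pick σ).rootedSize x : ℝ≥0∞) ≠ 0 :=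
          Nat.cast_ne_zero.2 (hUC.rootedSize_ne_zero hx)
        rw [div_eq_mul_inv, mul_assoc, ← ENNReal.mul_inv (.inr (ENNReal.natCast_ne_top _))
          (.inl (ENNReal.natCast_ne_top _)), mul_comm (((pick σ).size : ℕ) : ℝ≥0∞),
          ← Nat.cast_mul, hn, Nat.cast_mul, ENNReal.mul_inv (.inr (ENNReal.natCast_ne_top _))
          (.inl (ENNReal.natCast_ne_top _)), mul_comm, mul_assoc,
          ENNReal.inv_mul_cancel hr (ENNReal.natCast_ne_top _), mul_one]
      · rw [mul_zero]
    rw [Finset.sum_congr rfl key, hL.uniformExtension_apply]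
    by_cases hG : G ∈ σ.graph.extensions
    · obtain ⟨x, ⟨hx, hroot⟩, huniq⟩ := hUC.existsUnique_root (hL.restrict_mem_extensions hU hG)
      rw [if_pos hG, Finset.sum_eq_single_of_mem x hx fun y hy hyx =>
        if_neg fun h => hyx (huniq y ⟨hy, h.2⟩), if_pos ⟨hG, hroot⟩]
    · rw [if_neg hG]
      exact Finset.sum_eq_zero fun x _ => if_neg fun h => hG h.1
  · rw [step, dif_neg fun h => hne h.1, PMF.pure_bind]

end Valid

variable {K : MGraph V} {pick : SamplerState V → MGraph V}

/-- As long as there is work, every iteration lowers `undirCount` by at least one, so work can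
remain for only boundedly many iterations. -/
theorem valid_of_mem_support_run (hK : K.IsExtendable)
    (hpick : ∀ σ : SamplerState V, σ.work.Nonempty → pick σ ∈ σ.work) (n : ℕ) :
    ∀ σ ∈ (run pick K n).support,
      σ.Valid ∧ (σ.work = ∅ ∨ σ.graph.undirCount + n ≤ K.undirCount) := by
  induction n with
  | zero =>
    intro σ hσ
    rw [run, PMF.support_pure, Set.mem_singleton_iff] at hσ
    subst hσ
    exact ⟨⟨hK, rfl⟩, .inr le_rfl⟩
  | succ n ih =>
    intro τ hτ
    rw [run, PMF.mem_support_bind_iff] at hτ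
    obtain ⟨σ, hσ, hτ⟩ := hτ
    obtain ⟨hv, hcount⟩ := ih σ hσ
    rcases σ.work.eq_empty_or_nonempty with he | hne
    · rw [step, dif_neg fun h => h.1.ne_empty he, PMF.support_pure, Set.mem_singleton_iff] at hτ
      subst hτ
      exact ⟨hv, .inl he⟩
    · have hp := hpick σ hne
      obtain ⟨x, hx, rfl⟩ := hv.exists_of_mem_support_step hp hτ
      refine ⟨hv.next hp hx, .inr ?_⟩
      have h1 := hcount.resolve_left hne.ne_empty
      have h2 := undirCount_orient_lt hv.extendable (hv.work_eq ▸ hp) hx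
      change (σ.graph.orient _).undirCount + (n + 1) ≤ _
      omega

theorem run_bind (hK : K.IsExtendable)
    (hpick : ∀ σ : SamplerState V, σ.work.Nonempty → pick σ ∈ σ.work) (n : ℕ) :
    ((run pick K n).bind fun τ => τ.graph.uniformExtension) = K.uniformExtension := by
  induction n with
  | zero => rw [run, PMF.pure_bind]; rfl
  | succ n ih =>
    rw [run, PMF.bind_bind, ← ih]
    exact PMF.bind_congr_support _ fun σ hσ =>
      (valid_of_mem_support_run hK hpick n σ hσ).1.step_bind (hpick σ)

end SamplerState

open Classical in
theorem theorem3 {V : Type*} (K : MGraph V) (hK : K.IsEssential)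
    (pick : SamplerState V → MGraph V)
    (hpick : ∀ σ : SamplerState V, σ.work.Nonempty → pick σ ∈ σ.work) :
    (∃ N : ℕ, ∀ n ≥ N,
      (∀ σ ∈ (SamplerState.run pick K n).support, σ.work = ∅) ∧
      ∀ G : MGraph V, ((SamplerState.run pick K n).map SamplerState.graph) G =
        if G ∈ K.mec then 1 / (K.size : ℝ≥0∞) else 0) ∧
    (∀ n : ℕ, ∀ σ ∈ (SamplerState.run pick K n).support, ∀ U ∈ σ.work,
      U.IsUCEG ∧
      ∀ x ∈ U.verts, U.rootProb x = (U.rootedSize x : ℝ≥0∞) / (U.size : ℝ≥0∞)) := by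
  have hE := hK.isExtendable
  have hvalid := SamplerState.valid_of_mem_support_run hE hpick
  -- For `n > K.undirCount` the alternative `σ.graph.undirCount + n ≤ K.undirCount` is impossible,
  -- so the work set is empty.
  refine ⟨⟨K.undirCount + 1, fun n hn => ?_⟩, fun n σ hσ U hU => ?_⟩
  · have hempty : ∀ σ ∈ (SamplerState.run pick K n).support, σ.work = ∅ := fun σ hσ =>
      (hvalid n σ hσ).2.resolve_right (by omega)
    refine ⟨hempty, fun G => ?_⟩
    -- With an empty work set the graph is directed and its uniform distribution is a point mass, so
    -- the preserved average is the law of the output.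
    have hmap : (SamplerState.run pick K n).map SamplerState.graph = K.uniformExtension := by
      rw [← SamplerState.run_bind hE hpick n]
      refine PMF.bind_congr_support _ fun σ hσ => ?_
      have hv := (hvalid n σ hσ).1
      exact (hv.extendable.uniformExtension_eq_pure
        (MGraph.chainComponents_eq_empty_iff.1 (hv.work_eq ▸ hempty σ hσ))).symm
    rw [hmap, hE.uniformExtension_apply, MGraph.size, hK.mec_eq, one_div]
  · have hv := (hvalid n σ hσ).1
    have hUC := hv.extendable.isUCEG (hv.work_eq ▸ hU)
    exact ⟨hUC, fun x hx => hUC.rootProb_eq hx⟩
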